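/- **Theorem 2 (Uniform consistency of the S-location estimate).** Let $\rho:\mathbb R\to[0,\infty)$ be twice differentiable with $\rho(0)=0$ and suppose that (R.1) $\rho(-u)=\rho(u)$ for $u\ge 0$ and $\sup_u\rho(u)=1$; (R.2) $\rho$ is nondecreasing on $[0,\infty)$; (R.3) $|\rho'(u)|\le K<\infty$ for all $u$; (R.4) there is $0<c<\infty$ with $\rho(u)=1$ for all $|u|\ge c$. Let $b\in(0,1)$, $\varepsilon\in(0,1/2)$, $\mu_0\in\mathbb R$, $\sigma_0>0$, let $F_0$ be a symmetric distribution on $\mathbb R$, and let $$\mathcal H_\varepsilon=\{F: F(x)=(1-\varepsilon)F_0((x-\mu_0)/\sigma_0)+\varepsilon H(x),\ H \text{ an arbitrary distribution function}\}.$$ For $F\in\mathcal H_\varepsilon$ and $t\in\mathbb R$ let $\sigma(F,t)>0$ be the solution $s$ of $E_F\,\rho((X-t)/s)=b$, assumed to exist and to be unique (this is automatic, under the bounds below, if for example $F_0$ has a positive density). Let $\boldsymbol\sigma(F)=\inf_t\sigma(F,t)$, and let $0<s^-\le s^+<\infty$ satisfy $$s^-\le \boldsymbol\sigma(F)/\sigma_0\le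 s^+\qquad\text{for all }F\in\mathcal H_\varepsilon .$$ Suppose that there is $t^*\in\mathbb R$ such that $$\inf_{s^-\le s\le s^+}\Big[E_{F_0}\rho\Big(\frac{X-t}{s}\Big)-E_{F_0}\rho\Big(\frac{X}{s}\Big)\Big]>\frac{\varepsilon}{1-\varepsilon}\qquad\text{for all }|t|\ge t^* \tag{15}$$ and $$\inf_{|t|\le t^*,\ s^-\le s\le s^+}E_{F_0}\rho''\Big(\frac{X-t}{s}\Big)>\frac{\varepsilon}{1-\varepsilon}\,\sup_x[\rho''(x)]^-, \tag{16}$$ where $[a]^-=\max(-a,0)$. For a sample $x_1,\dots,x_n$ let $s_n(t)=\inf\{s>0:\frac1n\sum_{i=1}^n\rho((x_i-t)/s)\le b\}$, which is the solution of $\frac1n\sum_{i=1}^n\rho((x_i-t)/s)=b$ whenever there is exactly one. Then for every $F\in\mathcal H_\varepsilon$ the function $\sigma(F,\cdot)$ has a unique minimizer $\tilde{\boldsymbol\mu}(F)$; for every $n\ge1$ and every sample, $s_n(\cdot)$ has a minimizer; and for any choice $\tilde\mu_n$ of such minimizers (S-location estimates) and every $\delta>0$, $$\lim_{m\to\infty}\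 \sup_{F\in\mathcal H_\varepsilon}P_F\Big(\sup_{n\ge m}|\tilde\mu_n-\tilde{\boldsymbol\mu}(F)|>\delta\Big)=0,$$ where under $P_F$ the observations $x_1,x_2,\dots$ are i.i.d. with distribution $F$ (and $P_F$ denotes outer probability if the event is not measurable). -/

import Mathlib

open MeasureTheory Filter Topology Set

noncomputable section

/-- The M-scale solving `g s = b`, where `g s` is the mean of `ρ ((X - t) / s)` (a nonincreasing
function of the scale `s > 0`): the smallest `s` with `g s ≤ b`. When `g s = b` has exactly one
positive solution this is that solution; it is `0` in the degenerate case in which `g s ≤ b` for all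
`s > 0`, that is, when too large a fraction of the observations is tied at `t`. -/
def mScale (g : ℝ → ℝ) (b : ℝ) : ℝ := sInf {s : ℝ | 0 < s ∧ g s ≤ b}

/-- `E_F ρ((X - t) / s)`. -/
def meanRho (ρ : ℝ → ℝ) (F : Measure ℝ) (t s : ℝ) : ℝ := ∫ x, ρ ((x - t) / s) ∂F

/-- `(1 / n) ∑ᵢ ρ((xᵢ - t) / s)`. -/
def sampleMeanRho (ρ : ℝ → ℝ) {n : ℕ} (x : Fin n → ℝ) (t s : ℝ) : ℝ :=
  (1 / (n : ℝ)) * ∑ i, ρ ((x i - t) / s)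

/-- The scale `σ(F, t)` of the distribution `F` around `t`. -/
def scaleAt (ρ : ℝ → ℝ) (b : ℝ) (F : Measure ℝ) (t : ℝ) : ℝ := mScale (meanRho ρ F t) b

/-- The S-scale functional `σ(F) = inf_t σ(F, t)`. -/
def sScale (ρ : ℝ → ℝ) (b : ℝ) (F : Measure ℝ) : ℝ := ⨅ t : ℝ, scaleAt ρ b F t

/-- The scale `s_n(t)` of the sample `x` around `t`. -/
def sampleScaleAt (ρ : ℝ → ℝ) (b : ℝ) {n : ℕ} (x : Fin n → ℝ) (t : ℝ) : ℝ :=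
  mScale (sampleMeanRho ρ x t) b

/-- `t` is a value of the S-location functional at `F`: it minimizes `σ(F, ·)`. -/
def IsSLocation (ρ : ℝ → ℝ) (b : ℝ) (F : Measure ℝ) (t : ℝ) : Prop :=
  IsMinOn (scaleAt ρ b F) univ t

/-- `t` is an S-location estimate for the sample `x`: it minimizes `s_n(·)`. -/
def IsSampleSLocation (ρ : ℝ → ℝ) (b : ℝ) {n : ℕ} (x : Fin n → ℝ) (t : ℝ) : Prop :=
  IsMinOn (sampleScaleAt ρ b x) univ t

/-- The contamination neighborhood: all `F` with
`F(x) = (1 - ε) F₀((x - μ₀) / σ₀) + ε H(x)`, where `H` is an arbitrary distribution. -/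
def contamination (ε : ℝ) (F₀ : ProbabilityMeasure ℝ) (μ₀ σ₀ : ℝ) : Set (ProbabilityMeasure ℝ) :=
  {F | ∃ H : ProbabilityMeasure ℝ, (F : Measure ℝ) =
    ENNReal.ofReal (1 - ε) • (F₀ : Measure ℝ).map (fun x => μ₀ + σ₀ * x)
      + ENNReal.ofReal ε • (H : Measure ℝ)}

/-- Uniform consistency over a set `𝓗` of distributions of the sequence of estimates `T` to the
functional `τ`: for all `δ > 0`, `lim_m sup_{F ∈ 𝓗} P_F (sup_{n ≥ m} |T_n - τ(F)| > δ) = 0`.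
Here `P_F` is the law of an infinite i.i.d. sequence `ω` with distribution `F`, and `T_n` is
evaluated at the first `n` observations. -/
def UniformlyConsistent (𝓗 : Set (ProbabilityMeasure ℝ)) (T : (n : ℕ) → (Fin n → ℝ) → ℝ)
    (τ : ProbabilityMeasure ℝ → ℝ) : Prop :=
  ∀ δ : ℝ, 0 < δ →
    Tendsto (fun m : ℕ => ⨆ F ∈ 𝓗,
      Measure.infinitePi (fun _ : ℕ => (F : Measure ℝ))
        {ω : ℕ → ℝ | (δ : EReal) <
          ⨆ n ≥ m, ((|T n (fun i : Fin n => ω i) - τ F| : ℝ) : EReal)})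
      atTop (𝓝 0)

/-- The separation condition: for all `|t| ≥ t*`,
`inf_{s⁻ ≤ s ≤ s⁺} [E_{F₀} ρ((X - t)/s) - E_{F₀} ρ(X/s)] > ε / (1 - ε)`. -/
def SeparationCondition (ρ : ℝ → ℝ) (F₀ : Measure ℝ) (ε sMinus sPlus tStar : ℝ) : Prop :=
  ∀ t : ℝ, tStar ≤ |t| →
    ((ε / (1 - ε) : ℝ) : EReal) <
      ⨅ s ∈ Icc sMinus sPlus, ((∫ x, ρ ((x - t) / s) ∂F₀ - ∫ x, ρ (x / s) ∂F₀ : ℝ) : EReal)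

/-- The convexity condition:
`inf_{|t| ≤ t*, s⁻ ≤ s ≤ s⁺} E_{F₀} ρ''((X - t)/s) > ε / (1 - ε) * sup_x [ρ''(x)]⁻`, with infimum
and supremum in the extended reals (so it fails if `ρ''` is unbounded below). -/
def ConvexityCondition (ρ : ℝ → ℝ) (F₀ : Measure ℝ) (ε sMinus sPlus tStar : ℝ) : Prop :=
  ((ε / (1 - ε) : ℝ) : EReal) * (⨆ x : ℝ, ((max (-(deriv (deriv ρ) x)) 0 : ℝ) : EReal)) <
    ⨅ t ∈ Icc (-tStar) tStar, ⨅ s ∈ Icc sMinus sPlus,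
      ((∫ x, deriv (deriv ρ) ((x - t) / s) ∂F₀ : ℝ) : EReal)

end

/-!
The minimizers of `σ(F, ·)` are the minimizers of the mean loss `G(t) = E_F ρ((X - t) / S)` at the
S-scale `S = σ(F)`, whose minimal value is `b`. The separation condition keeps these minimizers in
the range `|t - μ₀| ≤ σ₀ t*`, where the convexity condition makes `G` strongly convex, the loss of
convexity due to the contamination being at most `ε * sup [ρ'']⁻`. All constants are uniform over
the neighborhood, so the minimum of `G` is uniformly well separated (`exists_growth`). Since `ρ''`
need be neither continuous nor bounded above, strong convexity is derived from Tonelli's theorem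
applied to `ρ'' + M ≥ 0` rather than by differentiating twice under the integral sign
(`convexOn_meanRho_sub_sq`).

Consequently the S-location is stable (`exists_stability`). Let `Q` have mean losses within `η` of
those of `F`, with S-locations `t_Q` and `t_F`. If `η` is small, then
`σ(Q, t_Q) ≤ σ(Q, t_F) ≤ (1 + γ) S`, so `E_F ρ((X - t_Q) / S)` is at most `b` plus a small
error, and the growth of `G` bounds `|t_Q - t_F|`. For the second inequality the mean loss at `t_F`
has to drop by a uniform amount between the scales `S` and `(1 + γ) S` (`exists_scale_gap`): if the
mean loss under `F₀` were constant between two scales, then some contamination would make both of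
them solve the equation defining the scale, against uniqueness; compactness makes this uniform.

With `Q = F`, stability gives uniqueness of the S-location. With `Q` the empirical measure it
reduces uniform consistency to a bound on the differences of mean losses, which are at most twice
the Kolmogorov distance (`abs_meanRho_sub_le`), because the superlevel sets of `ρ` are complements
of intervals. The latter is controlled uniformly over all distributions by Hoeffding's inequality
at finitely many quantiles (`tendsto_iSup_measure_exists_lt_abs_sub`). Existence of minimizers, for
`F` and for samples alike, is lower semicontinuity together with bounded sublevel sets
(`IsBoundedLoss.exists_isSLocation`).
-/

/-! ### Bounded loss functions and their means -/

/-- A bounded loss function: even, continuous, nondecreasing in `|u|`, rising from `0` at the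
origin to its maximal value `1`, which it takes outside `(-c, c)`. -/
structure IsBoundedLoss (ρ : ℝ → ℝ) (c : ℝ) : Prop where
  zero : ρ 0 = 0
  even : ∀ u, ρ (-u) = ρ u
  mono : MonotoneOn ρ (Ici 0)
  continuous : Continuous ρ
  c_pos : 0 < c
  eq_one : ∀ u, c ≤ |u| → ρ u = 1

namespace IsBoundedLoss

variable {ρ : ℝ → ℝ} {c : ℝ}

theorem apply_abs (hρ : IsBoundedLoss ρ c) (u : ℝ) : ρ |u| = ρ u := by
  rcases abs_choice u with h | h <;> rw [h]
  exact hρ.even u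

theorem le_of_abs_le (hρ : IsBoundedLoss ρ c) {u v : ℝ} (h : |u| ≤ |v|) : ρ u ≤ ρ v := by
  rw [← hρ.apply_abs u, ← hρ.apply_abs v]
  exact hρ.mono (abs_nonneg u) (abs_nonneg v) h

theorem nonneg (hρ : IsBoundedLoss ρ c) (u : ℝ) : 0 ≤ ρ u := by
  rw [← hρ.zero]
  exact hρ.le_of_abs_le (by simp)

theorem le_one (hρ : IsBoundedLoss ρ c) (u : ℝ) : ρ u ≤ 1 := by
  rw [← hρ.eq_one (max |u| c) (by rw [abs_of_nonneg (by positivity)]; exact le_max_right _ _)]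
  refine hρ.le_of_abs_le ?_
  rw [abs_of_nonneg (a := max |u| c) (by positivity)]
  exact le_max_left _ _

theorem norm_le_one (hρ : IsBoundedLoss ρ c) (u : ℝ) : ‖ρ u‖ ≤ 1 := by
  rw [Real.norm_of_nonneg (hρ.nonneg u)]
  exact hρ.le_one u

theorem integrable (hρ : IsBoundedLoss ρ c) (Q : Measure ℝ) [IsProbabilityMeasure Q] (t s : ℝ) :
    Integrable (fun x => ρ ((x - t) / s)) Q := by
  refine Integrable.of_bound (C := 1) ?_ (ae_of_all _ fun x => hρ.norm_le_one _)
  exact (hρ.continuous.comp (by fun_prop)).aestronglyMeasurable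

theorem meanRho_nonneg (hρ : IsBoundedLoss ρ c) (Q : Measure ℝ) (t s : ℝ) :
    0 ≤ meanRho ρ Q t s :=
  integral_nonneg fun _ => hρ.nonneg _

theorem meanRho_le_one (hρ : IsBoundedLoss ρ c) (Q : Measure ℝ) [IsProbabilityMeasure Q]
    (t s : ℝ) : meanRho ρ Q t s ≤ 1 := by
  calc meanRho ρ Q t s ≤ ∫ _, (1 : ℝ) ∂Q :=
        integral_mono (hρ.integrable Q t s) (integrable_const _) fun _ => hρ.le_one _
    _ = 1 := by simp

theorem meanRho_anti (hρ : IsBoundedLoss ρ c) (Q : Measure ℝ) [IsProbabilityMeasure Q]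
    (t : ℝ) {s s' : ℝ} (hs : 0 < s) (h : s ≤ s') : meanRho ρ Q t s' ≤ meanRho ρ Q t s := by
  refine integral_mono (hρ.integrable Q t s') (hρ.integrable Q t s) fun x => hρ.le_of_abs_le ?_
  rw [abs_div, abs_div, abs_of_pos hs, abs_of_pos (hs.trans_le h)]
  gcongr

theorem continuousOn_meanRho (hρ : IsBoundedLoss ρ c) (Q : Measure ℝ) [IsProbabilityMeasure Q] :
    ContinuousOn (fun p : ℝ × ℝ => meanRho ρ Q p.1 p.2) {p | 0 < p.2} := by
  unfold meanRho
  refine continuousOn_of_dominated (bound := fun _ => 1)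
    (fun p _ => (hρ.integrable Q p.1 p.2).aestronglyMeasurable)
    (fun p _ => ae_of_all _ fun x => hρ.norm_le_one _) (integrable_const _)
    (ae_of_all _ fun x => hρ.continuous.comp_continuousOn ?_)
  exact ContinuousOn.div (by fun_prop) (by fun_prop) fun p hp => (ne_of_gt hp)

theorem continuous_meanRho_left (hρ : IsBoundedLoss ρ c) (Q : Measure ℝ) [IsProbabilityMeasure Q]
    {s : ℝ} (hs : 0 < s) : Continuous fun t => meanRho ρ Q t s :=
  (hρ.continuousOn_meanRho Q).comp_continuous (f := fun t => (t, s)) (by fun_prop) fun _ => hs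

theorem continuousAt_meanRho_right (hρ : IsBoundedLoss ρ c) (Q : Measure ℝ)
    [IsProbabilityMeasure Q] (t : ℝ) {s : ℝ} (hs : 0 < s) :
    ContinuousAt (fun s => meanRho ρ Q t s) s := by
  have : ContinuousOn (fun s => meanRho ρ Q t s) (Ioi 0) :=
    (hρ.continuousOn_meanRho Q).comp (f := fun s => (t, s)) (by fun_prop) fun _ h => h
  exact this.continuousAt (Ioi_mem_nhds hs)

theorem tendsto_meanRho_cocompact (hρ : IsBoundedLoss ρ c) (Q : Measure ℝ)
    [IsProbabilityMeasure Q] {s : ℝ} (hs : 0 < s) :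
    Tendsto (fun t => meanRho ρ Q t s) (cocompact ℝ) (𝓝 1) := by
  have h1 : (1 : ℝ) = ∫ _, (1 : ℝ) ∂Q := by simp
  have : (cocompact ℝ).IsCountablyGenerated := by
    rw [cocompact_eq_atBot_atTop]
    infer_instance
  rw [h1]
  refine tendsto_integral_filter_of_dominated_convergence (fun _ => 1)
    (Eventually.of_forall fun t => (hρ.integrable Q t s).aestronglyMeasurable)
    (Eventually.of_forall fun t => ae_of_all _ fun x => hρ.norm_le_one _) (integrable_const _)
    (ae_of_all _ fun x => tendsto_const_nhds.congr' ?_)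
  filter_upwards [(tendsto_norm_cocompact_atTop (E := ℝ)).eventually_ge_atTop (|x| + c * s)]
    with t ht
  refine (hρ.eq_one _ ?_).symm
  rw [abs_div, abs_of_pos hs, le_div_iff₀ hs]
  have := abs_sub_abs_le_abs_sub t x
  rw [abs_sub_comm]
  rw [Real.norm_eq_abs] at ht
  linarith

theorem tendsto_meanRho_atTop (hρ : IsBoundedLoss ρ c) (Q : Measure ℝ)
    [IsProbabilityMeasure Q] (t : ℝ) :
    Tendsto (fun s => meanRho ρ Q t s) atTop (𝓝 0) := by
  have h1 : (0 : ℝ) = ∫ _, (0 : ℝ) ∂Q := by simp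
  rw [h1]
  refine tendsto_integral_filter_of_dominated_convergence (fun _ => 1)
    (Eventually.of_forall fun s => (hρ.integrable Q t s).aestronglyMeasurable)
    (Eventually.of_forall fun s => ae_of_all _ fun x => hρ.norm_le_one _) (integrable_const _)
    (ae_of_all _ fun x => ?_)
  have := (hρ.continuous.tendsto 0).comp
    (tendsto_const_nhds (x := x - t).div_atTop (tendsto_id (α := ℝ) (x := atTop)))
  rw [hρ.zero] at this
  exact this

/-! ### M-scales and S-location -/

theorem scaleAt_nonneg (ρ : ℝ → ℝ) (b : ℝ) (Q : Measure ℝ) (t : ℝ) : 0 ≤ scaleAt ρ b Q t :=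
  Real.sInf_nonneg fun _ h => h.1.le

/-- The M-scale and the mean of the loss are inverse to each other in the sense of a Galois
connection. This also holds in the degenerate case in which the M-scale is `0`. -/
theorem scaleAt_le_iff (hρ : IsBoundedLoss ρ c) {b : ℝ} (hb : 0 < b) (Q : Measure ℝ)
    [IsProbabilityMeasure Q] (t : ℝ) {s : ℝ} (hs : 0 < s) :
    scaleAt ρ b Q t ≤ s ↔ meanRho ρ Q t s ≤ b := by
  have hbdd : BddBelow {s : ℝ | 0 < s ∧ meanRho ρ Q t s ≤ b} := ⟨0, fun _ h => h.1.le⟩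
  constructor
  · intro h
    have hne : {s : ℝ | 0 < s ∧ meanRho ρ Q t s ≤ b}.Nonempty := by
      have h1 := (hρ.tendsto_meanRho_atTop Q t).eventually (Iic_mem_nhds hb)
      obtain ⟨s, hs1, hs2⟩ := (h1.and (eventually_gt_atTop 0)).exists
      exact ⟨s, hs2, hs1⟩
    -- every `s' > s` satisfies the inequality; continuity in the scale gives it at `s`
    have h2 : ∀ s' ∈ Ioi s, meanRho ρ Q t s' ≤ b := by
      intro s' hs'
      obtain ⟨r, hr, hrs⟩ := exists_lt_of_csInf_lt hne (lt_of_le_of_lt h hs')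
      exact (hρ.meanRho_anti Q t hr.1 hrs.le).trans hr.2
    refine le_of_tendsto ((hρ.continuousAt_meanRho_right Q t hs).tendsto.mono_left
      (nhdsWithin_le_nhds (s := Ioi s))) ?_
    exact eventually_mem_nhdsWithin.mono h2
  · intro h
    exact csInf_le hbdd ⟨hs, h⟩

theorem lowerSemicontinuous_scaleAt (hρ : IsBoundedLoss ρ c) {b : ℝ} (hb : 0 < b) (Q : Measure ℝ)
    [IsProbabilityMeasure Q] : LowerSemicontinuous (scaleAt ρ b Q) := by
  rw [lowerSemicontinuous_iff_isClosed_preimage]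
  intro y
  rcases lt_or_ge y 0 with hy | hy
  · convert isClosed_empty
    ext t
    simpa using lt_of_lt_of_le hy (scaleAt_nonneg ρ b Q t)
  · have : scaleAt ρ b Q ⁻¹' Iic y = ⋂ s : Ioi y, {t | meanRho ρ Q t s ≤ b} := by
      ext t
      simp only [mem_preimage, mem_Iic, mem_iInter, mem_ofPred_eq, Subtype.forall, mem_Ioi]
      constructor
      · intro h s hs
        exact (hρ.scaleAt_le_iff hb Q t (hy.trans_lt hs)).1 (h.trans hs.le)
      · intro h
        exact le_of_forall_gt_imp_ge_of_dense fun s hs =>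
          (hρ.scaleAt_le_iff hb Q t (hy.trans_lt hs)).2 (h s hs)
    rw [this]
    exact isClosed_iInter fun s =>
      isClosed_le (hρ.continuous_meanRho_left Q (hy.trans_lt s.2)) continuous_const

/-- The scale `σ(Q, ·)` attains its infimum: it is lower semicontinuous, and its sublevel sets are
bounded because the mean loss tends to `1 > b` as the location goes to infinity. -/
theorem exists_isSLocation (hρ : IsBoundedLoss ρ c) {b : ℝ} (hb : b ∈ Ioo (0 : ℝ) 1)
    (Q : Measure ℝ) [IsProbabilityMeasure Q] : ∃ t, IsSLocation ρ b Q t := by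
  set s := scaleAt ρ b Q 0 + 1 with hs
  have hs0 : 0 < s := by have := scaleAt_nonneg ρ b Q 0; linarith
  have h1 := (hρ.tendsto_meanRho_cocompact Q hs0).eventually (Ioi_mem_nhds hb.2)
  obtain ⟨K, hK, hKs⟩ := mem_cocompact.1 h1
  have hout : ∀ t, t ∉ K → s < scaleAt ρ b Q t := by
    intro t ht
    by_contra hle
    have h2 : b < meanRho ρ Q t s := hKs ht
    exact absurd ((hρ.scaleAt_le_iff hb.1 Q t hs0).1 (not_lt.1 hle)) (not_le.2 h2)
  have h0 : (0 : ℝ) ∈ K := by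
    by_contra h
    have := hout 0 h
    linarith
  obtain ⟨t, _, ht⟩ := LowerSemicontinuousOn.exists_isMinOn ⟨0, h0⟩ hK
    ((hρ.lowerSemicontinuous_scaleAt hb.1 Q).lowerSemicontinuousOn K)
  refine ⟨t, fun t' _ => ?_⟩
  by_cases h : t' ∈ K
  · exact ht h
  · have h3 := hout t' h
    have h4 : scaleAt ρ b Q t ≤ scaleAt ρ b Q 0 := ht h0
    show scaleAt ρ b Q t ≤ scaleAt ρ b Q t'
    linarith

theorem _root_.sScale_eq_of_isSLocation {b : ℝ} {Q : Measure ℝ} {t : ℝ}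
    (ht : IsSLocation ρ b Q t) : sScale ρ b Q = scaleAt ρ b Q t :=
  le_antisymm (ciInf_le ⟨0, by rintro _ ⟨t', rfl⟩; exact scaleAt_nonneg ρ b Q t'⟩ t)
    (le_ciInf fun t' => ht (mem_univ t'))

/-- At the S-scale the mean loss is at least `b` for every location. -/
theorem le_meanRho_sScale (hρ : IsBoundedLoss ρ c) {b : ℝ} (hb : 0 < b) (Q : Measure ℝ)
    [IsProbabilityMeasure Q] (hS : 0 < sScale ρ b Q) (t : ℝ) :
    b ≤ meanRho ρ Q t (sScale ρ b Q) := by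
  refine ge_of_tendsto ((hρ.continuousAt_meanRho_right Q t hS).tendsto.mono_left
    (nhdsWithin_le_nhds (s := Iio (sScale ρ b Q)))) ?_
  filter_upwards [Ioo_mem_nhdsLT hS] with s hs
  by_contra h
  have h1 := (hρ.scaleAt_le_iff hb Q t hs.1).2 (not_le.1 h).le
  have h2 : sScale ρ b Q ≤ scaleAt ρ b Q t :=
    ciInf_le ⟨0, by rintro _ ⟨t', rfl⟩; exact scaleAt_nonneg ρ b Q t'⟩ t
  linarith [hs.2]

/-- An S-location is a minimizer of the mean loss at the S-scale, with minimal value `b`. -/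
theorem meanRho_sScale_eq (hρ : IsBoundedLoss ρ c) {b : ℝ} (hb : 0 < b) (Q : Measure ℝ)
    [IsProbabilityMeasure Q] (hS : 0 < sScale ρ b Q) {t : ℝ} (ht : IsSLocation ρ b Q t) :
    meanRho ρ Q t (sScale ρ b Q) = b :=
  le_antisymm ((hρ.scaleAt_le_iff hb Q t hS).1 (sScale_eq_of_isSLocation ht).ge)
    (hρ.le_meanRho_sScale hb Q hS t)

end IsBoundedLoss

/-! ### Strong convexity of the mean loss -/

section Convexity

variable {ρ : ℝ → ℝ}

/-- The fundamental theorem of calculus for `t ↦ ρ' ((x - t) / s)`. As `ρ''` is only assumed to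
exist and to be bounded below, integrability is obtained from the nonnegativity of `ρ'' + M`. -/
theorem lintegral_deriv_deriv_add (hd2 : Differentiable ℝ (deriv ρ)) {M : ℝ}
    (hM : ∀ x, -M ≤ deriv (deriv ρ) x) {s : ℝ} (hs : 0 < s) {t₁ t₂ : ℝ} (ht : t₁ ≤ t₂) (x : ℝ) :
    ∫⁻ t in Ioc t₁ t₂, ENNReal.ofReal (deriv (deriv ρ) ((x - t) / s) + M) =
      ENNReal.ofReal (s * (deriv ρ ((x - t₁) / s) - deriv ρ ((x - t₂) / s)) + M * (t₂ - t₁)) := by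
  have hder : ∀ t, HasDerivAt (fun t => -(s * deriv ρ ((x - t) / s)) + M * t)
      (deriv (deriv ρ) ((x - t) / s) + M) t := by
    intro t
    have h1 : HasDerivAt (fun t : ℝ => (x - t) / s) (-1 / s) t :=
      ((hasDerivAt_id t).const_sub x).div_const s
    have h2 := ((((hd2 ((x - t) / s)).hasDerivAt.comp t h1).const_mul s).neg).add
      ((hasDerivAt_id t).const_mul M)
    refine h2.congr_deriv ?_
    field_simp
  have hnn : ∀ t, 0 ≤ deriv (deriv ρ) ((x - t) / s) + M := fun t => by
    linarith [hM ((x - t) / s)]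
  have hint : IntegrableOn (fun t => deriv (deriv ρ) ((x - t) / s) + M) (Ioc t₁ t₂) :=
    intervalIntegral.integrableOn_deriv_of_nonneg
      (fun t _ => (hder t).continuousAt.continuousWithinAt) (fun t _ => hder t) fun t _ => hnn t
  have hftc := intervalIntegral.integral_eq_sub_of_hasDerivAt (a := t₁) (b := t₂)
    (fun t _ => hder t) ((intervalIntegrable_iff_integrableOn_Ioc_of_le ht).2 hint)
  rw [intervalIntegral.integral_of_le ht] at hftc
  rw [← ofReal_integral_eq_lintegral_ofReal hint (ae_of_all _ hnn), hftc]
  congr 1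
  ring

theorem integrable_deriv_comp {K : ℝ} (hK : ∀ u, |deriv ρ u| ≤ K) (Q : Measure ℝ)
    [IsProbabilityMeasure Q] (t s : ℝ) : Integrable (fun x => deriv ρ ((x - t) / s)) Q := by
  refine Integrable.of_bound (C := K) ?_ (ae_of_all _ fun x => hK _)
  exact ((measurable_deriv ρ).comp (by fun_prop)).aestronglyMeasurable

/-- A lower bound `κ` on `E_Q ρ''((X - t) / s)`, written with nonnegative integrands so that it
needs no integrability, makes `E_Q ρ'((X - t) / s)` decrease in `t` at least at the rate
`κ / s`. -/
theorem mul_le_integral_deriv_sub (hd2 : Differentiable ℝ (deriv ρ)) {K : ℝ}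
    (hK : ∀ u, |deriv ρ u| ≤ K) {M κ : ℝ} (hM : ∀ x, -M ≤ deriv (deriv ρ) x) (Q : Measure ℝ)
    [IsProbabilityMeasure Q] {s : ℝ} (hs : 0 < s) {t₁ t₂ : ℝ} (ht : t₁ ≤ t₂)
    (hκ : ∀ t ∈ Icc t₁ t₂, ENNReal.ofReal (κ + M) ≤
      ∫⁻ x, ENNReal.ofReal (deriv (deriv ρ) ((x - t) / s) + M) ∂Q) :
    κ * (t₂ - t₁) ≤
      s * (∫ x, deriv ρ ((x - t₁) / s) ∂Q - ∫ x, deriv ρ ((x - t₂) / s) ∂Q) := by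
  have hi := fun t => integrable_deriv_comp hK Q t s
  set φ : ℝ → ℝ := fun x =>
    s * (deriv ρ ((x - t₁) / s) - deriv ρ ((x - t₂) / s)) + M * (t₂ - t₁) with hφ
  have hmono : ∀ a b, a ≤ b → 0 ≤ deriv ρ b - deriv ρ a + M * (b - a) := by
    have hm : Monotone fun u => deriv ρ u + M * u := by
      refine monotone_of_hasDerivAt_nonneg (f' := fun u => deriv (deriv ρ) u + M) (fun u => ?_)
        fun u => by show 0 ≤ deriv (deriv ρ) u + M; linarith [hM u]
      exact ((hd2 u).hasDerivAt.add ((hasDerivAt_id u).const_mul M)).congr_deriv (by simp)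
    intro a b hab
    have := hm hab
    simp only at this
    linarith
  have hφnn : ∀ x, 0 ≤ φ x := by
    intro x
    have h1 := hmono ((x - t₂) / s) ((x - t₁) / s) (by gcongr)
    have h2 : φ x = s * (deriv ρ ((x - t₁) / s) - deriv ρ ((x - t₂) / s) +
        M * ((x - t₁) / s - (x - t₂) / s)) := by
      simp only [hφ]
      field_simp
      ring
    rw [h2]
    positivity
  have hφi : Integrable φ Q := ((((hi t₁).sub (hi t₂)).const_mul s).add (integrable_const _))
  have hφint : ∫ x, φ x ∂Q =
      s * (∫ x, deriv ρ ((x - t₁) / s) ∂Q - ∫ x, deriv ρ ((x - t₂) / s) ∂Q) + M * (t₂ - t₁) := by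
    simp only [hφ]
    have h1 : Integrable
        (fun x => s * (deriv ρ ((x - t₁) / s) - deriv ρ ((x - t₂) / s))) Q :=
      ((hi t₁).sub (hi t₂)).const_mul s
    rw [integral_add h1 (integrable_const _), integral_const_mul, integral_sub (hi t₁) (hi t₂)]
    simp
  have key : ENNReal.ofReal ((κ + M) * (t₂ - t₁)) ≤ ENNReal.ofReal (∫ x, φ x ∂Q) := by
    rw [ofReal_integral_eq_lintegral_ofReal hφi (ae_of_all _ hφnn)]
    calc ENNReal.ofReal ((κ + M) * (t₂ - t₁))
        = ∫⁻ _ in Ioc t₁ t₂, ENNReal.ofReal (κ + M) := by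
          rw [setLIntegral_const, Real.volume_Ioc, ENNReal.ofReal_mul' (by linarith)]
      _ ≤ ∫⁻ t in Ioc t₁ t₂, ∫⁻ x, ENNReal.ofReal (deriv (deriv ρ) ((x - t) / s) + M) ∂Q :=
          setLIntegral_mono' measurableSet_Ioc fun t h => hκ t (Ioc_subset_Icc_self h)
      _ = ∫⁻ x, (∫⁻ t in Ioc t₁ t₂, ENNReal.ofReal (deriv (deriv ρ) ((x - t) / s) + M)) ∂Q := by
          refine lintegral_lintegral_swap (Measurable.aemeasurable ?_)
          refine ENNReal.measurable_ofReal.comp (Measurable.add_const ?_ _)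
          exact (measurable_deriv (deriv ρ)).comp (by fun_prop)
      _ = ∫⁻ x, ENNReal.ofReal (φ x) ∂Q :=
          lintegral_congr fun x => lintegral_deriv_deriv_add hd2 hM hs ht x
  have := (ENNReal.ofReal_le_ofReal_iff (integral_nonneg hφnn)).1 key
  rw [hφint] at this
  linarith

theorem hasDerivAt_meanRho {c : ℝ} (hρ : IsBoundedLoss ρ c) (hd : Differentiable ℝ ρ) {K : ℝ}
    (hK : ∀ u, |deriv ρ u| ≤ K) (Q : Measure ℝ) [IsProbabilityMeasure Q] (t s : ℝ) :
    HasDerivAt (fun t => meanRho ρ Q t s) (-(∫ x, deriv ρ ((x - t) / s) ∂Q) / s) t := by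
  have h := (hasDerivAt_integral_of_dominated_loc_of_deriv_le (μ := Q) (x₀ := t) (s := univ)
    (F := fun t x => ρ ((x - t) / s)) (F' := fun t x => -deriv ρ ((x - t) / s) / s)
    (bound := fun _ => K / |s|) univ_mem
    (Eventually.of_forall fun t => (hρ.integrable Q t s).aestronglyMeasurable)
    (hρ.integrable Q t s)
    (((integrable_deriv_comp hK Q t s).neg.div_const s).aestronglyMeasurable)
    (ae_of_all _ fun x t _ => by
      rw [norm_div, norm_neg, Real.norm_eq_abs, Real.norm_eq_abs]
      gcongr
      exact hK _)
    (integrable_const _)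
    (ae_of_all _ fun x t _ => by
      have h1 : HasDerivAt (fun t : ℝ => (x - t) / s) (-1 / s) t :=
        ((hasDerivAt_id t).const_sub x).div_const s
      refine ((hd ((x - t) / s)).hasDerivAt.comp t h1).congr_deriv ?_
      ring)).2
  refine h.congr_deriv ?_
  rw [integral_div, integral_neg]

/-- If `E_Q ρ''((X - t) / s) ≥ κ` for `t ∈ [l, r]`, then the mean loss is strongly convex in the
location on `[l, r]`, with modulus `κ / s ^ 2`. -/
theorem convexOn_meanRho_sub_sq {c : ℝ} (hρ : IsBoundedLoss ρ c) (hd : Differentiable ℝ ρ)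
    (hd2 : Differentiable ℝ (deriv ρ)) {K : ℝ} (hK : ∀ u, |deriv ρ u| ≤ K) {M κ : ℝ}
    (hM : ∀ x, -M ≤ deriv (deriv ρ) x) (Q : Measure ℝ) [IsProbabilityMeasure Q] {s : ℝ}
    (hs : 0 < s) {l r : ℝ}
    (hκ : ∀ t ∈ Icc l r, ENNReal.ofReal (κ + M) ≤
      ∫⁻ x, ENNReal.ofReal (deriv (deriv ρ) ((x - t) / s) + M) ∂Q) :
    ConvexOn ℝ (Icc l r) fun t => meanRho ρ Q t s - κ / (2 * s ^ 2) * t ^ 2 := by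
  have hder : ∀ t, HasDerivAt (fun t => meanRho ρ Q t s - κ / (2 * s ^ 2) * t ^ 2)
      (-(∫ x, deriv ρ ((x - t) / s) ∂Q) / s - κ / s ^ 2 * t) t := by
    intro t
    refine ((hasDerivAt_meanRho hρ hd hK Q t s).sub
      ((hasDerivAt_pow 2 t).const_mul (κ / (2 * s ^ 2)))).congr_deriv ?_
    simp only [Nat.cast_ofNat, Nat.add_one_sub_one, pow_one]
    field_simp
  refine MonotoneOn.convexOn_of_deriv (convex_Icc l r)
    (fun t _ => (hder t).continuousAt.continuousWithinAt)
    (fun t _ => (hder t).differentiableAt.differentiableWithinAt) ?_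
  intro t₁ h₁ t₂ h₂ h
  rw [(hder t₁).deriv, (hder t₂).deriv]
  have h₁' := interior_subset h₁
  have h₂' := interior_subset h₂
  have := mul_le_integral_deriv_sub hd2 hK hM Q hs h
    fun t ht => hκ t ⟨h₁'.1.trans ht.1, ht.2.trans h₂'.2⟩
  rw [← sub_nonneg]
  have h3 : -(∫ x, deriv ρ ((x - t₂) / s) ∂Q) / s - κ / s ^ 2 * t₂ -
      (-(∫ x, deriv ρ ((x - t₁) / s) ∂Q) / s - κ / s ^ 2 * t₁) =
      (s * (∫ x, deriv ρ ((x - t₁) / s) ∂Q - ∫ x, deriv ρ ((x - t₂) / s) ∂Q) -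
        κ * (t₂ - t₁)) / s ^ 2 := by
    field_simp
    ring
  rw [h3]
  exact div_nonneg (by linarith) (by positivity)

/-- Quadratic growth of a strongly convex function away from a minimizer. -/
theorem le_sub_of_convexOn_sub_sq {D : Set ℝ} {f : ℝ → ℝ} {a : ℝ}
    (hf : ConvexOn ℝ D fun t => f t - a * t ^ 2) {t₀ t : ℝ} (h₀ : t₀ ∈ D) (ht : t ∈ D)
    (hmin : ∀ t, f t₀ ≤ f t) : a / 2 * (t - t₀) ^ 2 ≤ f t - f t₀ := by
  have h := hf.2 h₀ ht (show (0 : ℝ) ≤ 1 / 2 by norm_num) (show (0 : ℝ) ≤ 1 / 2 by norm_num)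
    (by norm_num)
  simp only [smul_eq_mul] at h
  have h2 := hmin (1 / 2 * t₀ + 1 / 2 * t)
  nlinarith

end Convexity

/-! ### The contamination neighborhood -/

section Contamination

variable {ρ : ℝ → ℝ} {c : ℝ}

theorem meanRho_contamination (hρ : IsBoundedLoss ρ c) {ε μ₀ σ₀ : ℝ} (hε : ε ∈ Ioo (0 : ℝ) (1 / 2))
    (hσ₀ : 0 < σ₀) {F₀ F H : ProbabilityMeasure ℝ}
    (hF : (F : Measure ℝ) = ENNReal.ofReal (1 - ε) • (F₀ : Measure ℝ).map (fun x => μ₀ + σ₀ * x)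
      + ENNReal.ofReal ε • (H : Measure ℝ)) (t s : ℝ) :
    meanRho ρ F t s =
      (1 - ε) * meanRho ρ F₀ ((t - μ₀) / σ₀) (s / σ₀) + ε * meanRho ρ H t s := by
  have hm : Measurable fun x : ℝ => μ₀ + σ₀ * x := by fun_prop
  have : IsProbabilityMeasure ((F₀ : Measure ℝ).map fun x => μ₀ + σ₀ * x) :=
    Measure.isProbabilityMeasure_map hm.aemeasurable
  unfold meanRho
  rw [hF, integral_add_measure ((hρ.integrable _ t s).smul_measure ENNReal.ofReal_ne_top)
    ((hρ.integrable _ t s).smul_measure ENNReal.ofReal_ne_top), integral_smul_measure,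
    integral_smul_measure, ENNReal.toReal_ofReal (by linarith [hε.2]),
    ENNReal.toReal_ofReal hε.1.le, integral_map hm.aemeasurable
      (hρ.integrable _ t s).aestronglyMeasurable]
  simp only [smul_eq_mul]
  congr 2
  refine integral_congr_ae (ae_of_all _ fun x => ?_)
  show ρ _ = ρ _
  congr 1
  field_simp
  ring

theorem exists_mem_contamination {ε : ℝ} (hε : ε ∈ Ioo (0 : ℝ) (1 / 2)) (F₀ : ProbabilityMeasure ℝ)
    (μ₀ σ₀ : ℝ) (H : ProbabilityMeasure ℝ) :
    ∃ F : ProbabilityMeasure ℝ, (F : Measure ℝ) =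
      ENNReal.ofReal (1 - ε) • (F₀ : Measure ℝ).map (fun x => μ₀ + σ₀ * x)
        + ENNReal.ofReal ε • (H : Measure ℝ) := by
  have hm : Measurable fun x : ℝ => μ₀ + σ₀ * x := by fun_prop
  have : IsProbabilityMeasure ((F₀ : Measure ℝ).map fun x => μ₀ + σ₀ * x) :=
    Measure.isProbabilityMeasure_map hm.aemeasurable
  refine ⟨⟨ENNReal.ofReal (1 - ε) • (F₀ : Measure ℝ).map (fun x => μ₀ + σ₀ * x)
        + ENNReal.ofReal ε • (H : Measure ℝ), ⟨?_⟩⟩, rfl⟩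
  simp only [Measure.coe_add, Measure.coe_smul, Pi.add_apply, Pi.smul_apply, measure_univ,
    smul_eq_mul, mul_one]
  rw [← ENNReal.ofReal_add (by linarith [hε.2]) hε.1.le]
  simp

/-- Contamination split between the center `t` and a point far from it takes any prescribed
mean loss `p`, which does not depend on the scale up to `s'`. -/
theorem exists_meanRho_eq (hρ : IsBoundedLoss ρ c) {p : ℝ} (hp : p ∈ Icc (0 : ℝ) 1) (t : ℝ)
    {s' : ℝ} (hs' : 0 < s') :
    ∃ H : ProbabilityMeasure ℝ, ∀ s, 0 < s → s ≤ s' → meanRho ρ H t s = p := by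
  have hP : IsProbabilityMeasure (ENNReal.ofReal (1 - p) • Measure.dirac t +
      ENNReal.ofReal p • Measure.dirac (t + c * s')) := by
    constructor
    simp only [Measure.coe_add, Measure.coe_smul, Pi.add_apply, Pi.smul_apply, measure_univ,
      smul_eq_mul, mul_one]
    rw [← ENNReal.ofReal_add (by linarith [hp.2]) hp.1]
    simp
  refine ⟨⟨_, hP⟩, fun s hs hss' => ?_⟩
  unfold meanRho
  simp only [ProbabilityMeasure.coe_mk]
  rw [integral_add_measure ((hρ.integrable _ t s).smul_measure ENNReal.ofReal_ne_top)
    ((hρ.integrable _ t s).smul_measure ENNReal.ofReal_ne_top), integral_smul_measure,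
    integral_smul_measure, integral_dirac, integral_dirac,
    ENNReal.toReal_ofReal (by linarith [hp.2]), ENNReal.toReal_ofReal hp.1]
  rw [hρ.eq_one ((t + c * s' - t) / s), sub_self, zero_div, hρ.zero]
  · simp
  · rw [add_sub_cancel_left, abs_of_pos (div_pos (mul_pos hρ.c_pos hs') hs), le_div_iff₀ hs]
    exact mul_le_mul_of_nonneg_left hss' hρ.c_pos.le

/-- Uniqueness of the scale over the whole neighborhood forces the mean loss under `F₀` to be
strictly decreasing in the scale wherever the contamination can bring the total mean loss to the
level `b`: on a flat piece a suitable contamination would produce two solutions. -/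
theorem meanRho_lt_of_existsUnique (hρ : IsBoundedLoss ρ c) {b ε μ₀ σ₀ : ℝ}
    (hε : ε ∈ Ioo (0 : ℝ) (1 / 2)) (hσ₀ : 0 < σ₀) {F₀ : ProbabilityMeasure ℝ}
    (hscale : ∀ F ∈ contamination ε F₀ μ₀ σ₀, ∀ t : ℝ, ∃! s : ℝ, 0 < s ∧ meanRho ρ F t s = b)
    {u s s' : ℝ} (hs : 0 < s) (hss' : s < s') (h₁ : (1 - ε) * meanRho ρ F₀ u s ≤ b)
    (h₂ : b ≤ (1 - ε) * meanRho ρ F₀ u s + ε) : meanRho ρ F₀ u s' < meanRho ρ F₀ u s := by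
  refine lt_of_le_of_ne (hρ.meanRho_anti _ u hs hss'.le) fun heq => ?_
  obtain ⟨H, hH⟩ := exists_meanRho_eq hρ (p := (b - (1 - ε) * meanRho ρ F₀ u s) / ε)
    ⟨div_nonneg (by linarith) hε.1.le, (div_le_one hε.1).2 (by linarith)⟩ (μ₀ + σ₀ * u)
    (s' := σ₀ * s') (mul_pos hσ₀ (hs.trans hss'))
  obtain ⟨F, hF⟩ := exists_mem_contamination hε F₀ μ₀ σ₀ H
  have hval : ∀ r, 0 < r → r ≤ s' → meanRho ρ F₀ u r = meanRho ρ F₀ u s →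
      meanRho ρ F (μ₀ + σ₀ * u) (σ₀ * r) = b := by
    intro r hr hrs' hr2
    rw [meanRho_contamination hρ hε hσ₀ hF, hH _ (mul_pos hσ₀ hr)
      (mul_le_mul_of_nonneg_left hrs' hσ₀.le)]
    rw [add_sub_cancel_left, mul_div_cancel_left₀ _ hσ₀.ne', mul_div_cancel_left₀ _ hσ₀.ne', hr2]
    have := hε.1.ne'
    field_simp
    ring
  obtain ⟨r, _, hr⟩ := hscale F ⟨H, hF⟩ (μ₀ + σ₀ * u)
  have e₁ := hr (σ₀ * s) ⟨mul_pos hσ₀ hs, hval s hs hss'.le rfl⟩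
  have e₂ := hr (σ₀ * s') ⟨mul_pos hσ₀ (hs.trans hss'), hval s' (hs.trans hss') le_rfl heq⟩
  have := mul_left_cancel₀ hσ₀.ne' (e₁.trans e₂.symm)
  linarith

/-- The strict monotonicity of `meanRho_lt_of_existsUnique`, uniformly over a compact set. -/
theorem exists_scale_gap (hρ : IsBoundedLoss ρ c) {b ε μ₀ σ₀ : ℝ}
    (hε : ε ∈ Ioo (0 : ℝ) (1 / 2)) (hσ₀ : 0 < σ₀) {F₀ : ProbabilityMeasure ℝ}
    (hscale : ∀ F ∈ contamination ε F₀ μ₀ σ₀, ∀ t : ℝ, ∃! s : ℝ, 0 < s ∧ meanRho ρ F t s = b)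
    {sMinus sPlus tStar : ℝ} (hsMinus : 0 < sMinus) {γ : ℝ} (hγ : 0 < γ) :
    ∃ η, 0 < η ∧ ∀ u ∈ Icc (-tStar) tStar, ∀ s ∈ Icc sMinus sPlus,
      (1 - ε) * meanRho ρ F₀ u s ≤ b → b ≤ (1 - ε) * meanRho ρ F₀ u s + ε →
        η ≤ meanRho ρ F₀ u s - meanRho ρ F₀ u ((1 + γ) * s) := by
  set D : Set (ℝ × ℝ) := Icc (-tStar) tStar ×ˢ Icc sMinus sPlus with hD
  have hpos : ∀ p ∈ D, 0 < p.2 := fun p hp => hsMinus.trans_le hp.2.1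
  have hcont : ContinuousOn (fun p : ℝ × ℝ => meanRho ρ F₀ p.1 p.2) D :=
    (hρ.continuousOn_meanRho F₀).mono hpos
  have hcont' : ContinuousOn (fun p : ℝ × ℝ => meanRho ρ F₀ p.1 ((1 + γ) * p.2)) D :=
    (hρ.continuousOn_meanRho F₀).comp (f := fun p : ℝ × ℝ => (p.1, (1 + γ) * p.2))
      (by fun_prop) fun p hp => mul_pos (by linarith) (hpos p hp)
  have hDc : IsCompact D := isCompact_Icc.prod isCompact_Icc
  have hcl := hcont.preimage_isClosed_of_isClosed hDc.isClosed
    (isClosed_Icc (a := (b - ε) / (1 - ε)) (b := b / (1 - ε)))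
  have h1ε : 0 < 1 - ε := by linarith [hε.2]
  obtain ⟨η, hη, hη'⟩ := (hDc.of_isClosed_subset hcl inter_subset_left).exists_forall_le'
    ((hcont.sub hcont').mono inter_subset_left) (a := 0) (by
      rintro ⟨u, s⟩ ⟨hp, hp1, hp2⟩
      rw [div_le_iff₀ h1ε] at hp1
      rw [le_div_iff₀ h1ε] at hp2
      have hs : 0 < s := hpos _ hp
      exact sub_pos.2 (meanRho_lt_of_existsUnique hρ hε hσ₀ hscale hs
        (by nlinarith) (by linarith) (by linarith)))
  refine ⟨η, hη, fun u hu s hs h₁ h₂ => hη' (u, s) ⟨⟨hu, hs⟩, ?_, ?_⟩⟩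
  · rw [div_le_iff₀ h1ε]
    linarith
  · rw [le_div_iff₀ h1ε]
    linarith

/-- The separation condition is uniform in the location: far out, the mean loss is close to `1`,
uniformly in the scale by monotonicity. -/
theorem SeparationCondition.exists_uniform (hρ : IsBoundedLoss ρ c) {ε sMinus sPlus tStar : ℝ}
    {F₀ : ProbabilityMeasure ℝ} (hsMinus : 0 < sMinus) (hs : sMinus ≤ sPlus)
    (hsep : SeparationCondition ρ F₀ ε sMinus sPlus tStar) :
    ∃ κ, 0 < κ ∧ ∀ t, tStar ≤ |t| → ∀ s ∈ Icc sMinus sPlus,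
      ε / (1 - ε) + κ ≤ meanRho ρ F₀ t s - meanRho ρ F₀ 0 s := by
  have hsep' : ∀ t, tStar ≤ |t| → ∀ s ∈ Icc sMinus sPlus,
      ε / (1 - ε) < meanRho ρ F₀ t s - meanRho ρ F₀ 0 s := by
    intro t ht s hs
    have := (hsep t ht).trans_le (iInf₂_le s hs)
    rw [EReal.coe_lt_coe_iff] at this
    simpa [meanRho] using this
  set q := ε / (1 - ε)
  have hq : meanRho ρ F₀ 0 sMinus + q < 1 := by
    have h1 := hsep' tStar (le_abs_self _) sMinus ⟨le_rfl, hs⟩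
    have h2 := hρ.meanRho_le_one F₀ tStar sMinus
    linarith
  set κ₁ := (1 - (meanRho ρ F₀ 0 sMinus + q)) / 2 with hκ₁
  have hκ₁_pos : 0 < κ₁ := by linarith
  have hev := (hρ.tendsto_meanRho_cocompact F₀ (hsMinus.trans_le hs)).eventually
    (Ioi_mem_nhds (show 1 - κ₁ < 1 by linarith))
  obtain ⟨K, hK, hKs⟩ := mem_cocompact.1 hev
  set D : Set (ℝ × ℝ) := (K ∩ {t | tStar ≤ |t|}) ×ˢ Icc sMinus sPlus with hD
  have hDc : IsCompact D :=
    (hK.inter_right (isClosed_le continuous_const continuous_abs)).prod isCompact_Icc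
  have hpos : ∀ p ∈ D, 0 < p.2 := fun p hp => hsMinus.trans_le hp.2.1
  have hcont : ContinuousOn (fun p : ℝ × ℝ => meanRho ρ F₀ p.1 p.2 - meanRho ρ F₀ 0 p.2) D :=
    ((hρ.continuousOn_meanRho F₀).mono hpos).sub
      ((hρ.continuousOn_meanRho F₀).comp (f := fun p : ℝ × ℝ => ((0 : ℝ), p.2)) (by fun_prop) hpos)
  obtain ⟨q', hq', hq'2⟩ := hDc.exists_forall_le' hcont (a := q)
    fun p hp => hsep' p.1 hp.1.2 p.2 hp.2
  refine ⟨min κ₁ (q' - q), lt_min hκ₁_pos (by linarith), fun t ht s hss => ?_⟩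
  by_cases htK : t ∈ K
  · have h1 := hq'2 (t, s) ⟨⟨htK, ht⟩, hss⟩
    have h2 := min_le_right κ₁ (q' - q)
    simp only at h1
    linarith
  · have h1 : 1 - κ₁ < meanRho ρ F₀ t sPlus := hKs htK
    have h2 := hρ.meanRho_anti F₀ t (hsMinus.trans_le hss.1) hss.2
    have h3 := hρ.meanRho_anti F₀ 0 hsMinus hss.1
    have h4 := min_le_left κ₁ (q' - q)
    linarith

/-- The convexity condition in terms of real constants: `ρ''` is bounded below by some `-M`, and
`E_{F₀} ρ''((X - t) / s)` exceeds a constant greater than `ε / (1 - ε) * M`. The integral of `ρ''`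
exists, since otherwise its conventional value `0` would violate the condition. -/
theorem ConvexityCondition.exists_bounds {ε sMinus sPlus tStar : ℝ} {F₀ : ProbabilityMeasure ℝ}
    (hε : ε ∈ Ioo (0 : ℝ) (1 / 2)) (hconv : ConvexityCondition ρ F₀ ε sMinus sPlus tStar) :
    ∃ M κ : ℝ, (∀ x, -M ≤ deriv (deriv ρ) x) ∧ ε / (1 - ε) * M < κ ∧
      ∀ t ∈ Icc (-tStar) tStar, ∀ s ∈ Icc sMinus sPlus,
        ENNReal.ofReal (κ + M) ≤
          ∫⁻ x, ENNReal.ofReal (deriv (deriv ρ) ((x - t) / s) + M) ∂(F₀ : Measure ℝ) := by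
  have hq : 0 < ε / (1 - ε) := div_pos hε.1 (by linarith [hε.2])
  unfold ConvexityCondition at hconv
  set X : EReal := ⨆ x : ℝ, ((max (-(deriv (deriv ρ) x)) 0 : ℝ) : EReal) with hX
  have hXle : ∀ x : ℝ, ((max (-(deriv (deriv ρ) x)) 0 : ℝ) : EReal) ≤ X :=
    fun x => le_iSup (fun x : ℝ => ((max (-(deriv (deriv ρ) x)) 0 : ℝ) : EReal)) x
  have hX0 : 0 ≤ X := le_trans (by exact_mod_cast le_max_right _ _) (hXle 0)
  have hXtop : X ≠ ⊤ := by
    intro h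
    rw [h, EReal.coe_mul_top_of_pos hq] at hconv
    exact not_top_lt hconv
  have hXbot : X ≠ ⊥ := fun h => by simp [h] at hX0
  lift X to ℝ using ⟨hXtop, hXbot⟩ with M
  have hM0 : 0 ≤ M := by exact_mod_cast hX0
  have hM : ∀ x, -M ≤ deriv (deriv ρ) x := by
    intro x
    have h1 : max (-(deriv (deriv ρ) x)) 0 ≤ M := by exact_mod_cast hXle x
    have h2 := le_max_left (-(deriv (deriv ρ) x)) 0
    linarith
  obtain ⟨κ, hκ₁, hκ₂⟩ := EReal.lt_iff_exists_real_btwn.1 hconv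
  have hκ : ε / (1 - ε) * M < κ := by exact_mod_cast hκ₁
  refine ⟨M, κ, hM, hκ, fun t ht s hs => ?_⟩
  have hlt : κ < ∫ x, deriv (deriv ρ) ((x - t) / s) ∂(F₀ : Measure ℝ) := by
    have := hκ₂.trans_le ((iInf₂_le t ht).trans (iInf₂_le s hs))
    exact_mod_cast this
  have hκ0 : 0 ≤ κ := (mul_nonneg hq.le hM0).trans hκ.le
  have hint : Integrable (fun x => deriv (deriv ρ) ((x - t) / s)) (F₀ : Measure ℝ) := by
    by_contra h
    rw [integral_undef h] at hlt
    linarith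
  have hint' : Integrable (fun x => deriv (deriv ρ) ((x - t) / s) + M) (F₀ : Measure ℝ) :=
    hint.add (integrable_const M)
  rw [← ofReal_integral_eq_lintegral_ofReal hint' (ae_of_all _ fun x => by
      show 0 ≤ deriv (deriv ρ) ((x - t) / s) + M
      linarith [hM ((x - t) / s)]), integral_add hint (integrable_const M)]
  refine ENNReal.ofReal_le_ofReal ?_
  simp
  linarith

end Contamination

/-! ### Stability of the S-location functional -/

section Stability

variable {ρ : ℝ → ℝ} {c : ℝ}

/-- The mean loss at the S-scale has a minimum that is well separated, uniformly over the
contamination neighborhood: for locations far from the center by the separation condition, and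
near the center by strong convexity. -/
theorem exists_growth (hρ : IsBoundedLoss ρ c) (hd : Differentiable ℝ ρ)
    (hd2 : Differentiable ℝ (deriv ρ)) {K : ℝ} (hK : ∀ u, |deriv ρ u| ≤ K)
    {ε μ₀ σ₀ : ℝ} (hε : ε ∈ Ioo (0 : ℝ) (1 / 2)) (hσ₀ : 0 < σ₀) {F₀ : ProbabilityMeasure ℝ}
    {sMinus sPlus tStar : ℝ} (hsMinus : 0 < sMinus) (hs : sMinus ≤ sPlus)
    (hsep : SeparationCondition ρ F₀ ε sMinus sPlus tStar)
    (hconv : ConvexityCondition ρ F₀ ε sMinus sPlus tStar) :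
    ∃ κ a : ℝ, 0 < κ ∧ 0 < a ∧ ∀ F ∈ contamination ε F₀ μ₀ σ₀, ∀ S, S / σ₀ ∈ Icc sMinus sPlus →
      ∀ t₀, (∀ t, meanRho ρ F t₀ S ≤ meanRho ρ F t S) →
        (t₀ - μ₀) / σ₀ ∈ Icc (-tStar) tStar ∧
          ∀ t, min κ (a * (t - t₀) ^ 2) ≤ meanRho ρ F t S - meanRho ρ F t₀ S := by
  have h1ε : 0 < 1 - ε := by linarith [hε.2]
  obtain ⟨κ, hκ, hκ'⟩ := hsep.exists_uniform hρ hsMinus hs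
  obtain ⟨M, k, hM, hk, hk'⟩ := hconv.exists_bounds hε
  set k' := (1 - ε) * (k + M) - M with hk'_def
  have hk'_pos : 0 < k' := by
    rw [div_mul_eq_mul_div, div_lt_iff₀ h1ε] at hk
    linarith
  refine ⟨(1 - ε) * κ, k' / (4 * (sPlus * σ₀) ^ 2), by positivity, ?_, ?_⟩
  · have : 0 < sPlus := hsMinus.trans_le hs
    positivity
  rintro F ⟨H, hF⟩ S hS t₀ hmin
  have hS0 : 0 < S := by
    have := mul_pos (hsMinus.trans_le hS.1) hσ₀
    rwa [div_mul_cancel₀ _ hσ₀.ne'] at this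
  have hfar : ∀ t, tStar ≤ |(t - μ₀) / σ₀| →
      (1 - ε) * κ ≤ meanRho ρ F t S - meanRho ρ F μ₀ S := by
    intro t ht
    have h1 := hκ' _ ht _ hS
    have h2 := hρ.meanRho_nonneg H t S
    have h3 := hρ.meanRho_le_one H μ₀ S
    rw [meanRho_contamination hρ hε hσ₀ hF, meanRho_contamination hρ hε hσ₀ hF, sub_self, zero_div]
    have h4 := mul_le_mul_of_nonneg_left h1 h1ε.le
    rw [mul_add, mul_div_cancel₀ _ h1ε.ne'] at h4
    have h5 := mul_le_mul_of_nonneg_left h2 hε.1.le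
    have h6 := mul_le_mul_of_nonneg_left h3 hε.1.le
    linarith
  have hmem : ∀ t, t ∈ Icc (μ₀ - σ₀ * tStar) (μ₀ + σ₀ * tStar) ↔
      (t - μ₀) / σ₀ ∈ Icc (-tStar) tStar := by
    intro t
    rw [mem_Icc, mem_Icc, le_div_iff₀ hσ₀, div_le_iff₀ hσ₀]
    constructor <;> rintro ⟨h1, h2⟩ <;> constructor <;> linarith
  have ht₀ : (t₀ - μ₀) / σ₀ ∈ Icc (-tStar) tStar := by
    rw [mem_Icc, ← abs_le]
    by_contra h
    have h1 := hfar t₀ (not_le.1 h).le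
    have h2 := hmin μ₀
    have := mul_pos h1ε hκ
    linarith
  refine ⟨ht₀, fun t => ?_⟩
  by_cases ht : (t - μ₀) / σ₀ ∈ Icc (-tStar) tStar
  · have hcx := convexOn_meanRho_sub_sq hρ hd hd2 hK (κ := k') hM F hS0
      (l := μ₀ - σ₀ * tStar) (r := μ₀ + σ₀ * tStar) (by
        intro t ht
        have hmeas : Measurable fun x => ENNReal.ofReal (deriv (deriv ρ) ((x - t) / S) + M) :=
          ENNReal.measurable_ofReal.comp
            (((measurable_deriv (deriv ρ)).comp (by fun_prop)).add_const _)
        rw [hF, lintegral_add_measure, lintegral_smul_measure, lintegral_map hmeas (by fun_prop),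
          hk'_def, sub_add_cancel, ENNReal.ofReal_mul h1ε.le, smul_eq_mul]
        refine le_add_right (mul_le_mul_right ((hk' _ ((hmem t).1 ht) _ hS).trans_eq ?_) _)
        refine lintegral_congr fun x => ?_
        congr 3
        field_simp
        ring)
    have h1 := le_sub_of_convexOn_sub_sq hcx ((hmem t₀).2 ht₀) ((hmem t).2 ht) hmin
    refine (min_le_right _ _).trans (le_trans ?_ h1)
    have hS2 : S ≤ sPlus * σ₀ := (div_le_iff₀ hσ₀).1 hS.2
    have : k' / (2 * S ^ 2) / 2 = k' / (4 * S ^ 2) := by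
      field_simp
      norm_num
    rw [this]
    gcongr
  · have h1 : tStar ≤ |(t - μ₀) / σ₀| := by
      rw [mem_Icc, ← abs_le] at ht
      exact (not_le.1 ht).le
    have h2 := hmin μ₀
    exact (min_le_left _ _).trans (by linarith [hfar t h1])

theorem meanRho_sub_le_of_scale (hρ : IsBoundedLoss ρ c) (hd : Differentiable ℝ ρ) {K : ℝ}
    (hK : ∀ u, |deriv ρ u| ≤ K) (Q : Measure ℝ) [IsProbabilityMeasure Q] (t s : ℝ) {γ : ℝ}
    (hγ : 0 < γ) : meanRho ρ Q t s - meanRho ρ Q t ((1 + γ) * s) ≤ K * c * γ := by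
  have hK0 : 0 ≤ K := (abs_nonneg _).trans (hK 0)
  have hpt : ∀ v, ρ v - ρ (v / (1 + γ)) ≤ K * c * γ := by
    intro v
    have h1γ : 0 < 1 + γ := by linarith
    by_cases h : c ≤ |v / (1 + γ)|
    · rw [hρ.eq_one _ h]
      have h2 := hρ.le_one v
      have h3 : 0 ≤ K * c * γ := mul_nonneg (mul_nonneg hK0 hρ.c_pos.le) hγ.le
      linarith
    · have h1 := Convex.norm_image_sub_le_of_norm_deriv_le (s := univ) (fun x _ => hd x)
        (fun x _ => (Real.norm_eq_abs _).trans_le (hK x)) convex_univ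
        (mem_univ (v / (1 + γ))) (mem_univ v)
      have h2 : v - v / (1 + γ) = v / (1 + γ) * γ := by
        field_simp
        ring
      rw [h2, Real.norm_eq_abs, Real.norm_eq_abs, abs_mul, abs_of_pos hγ] at h1
      calc ρ v - ρ (v / (1 + γ)) ≤ _ := le_abs_self _
        _ ≤ _ := h1
        _ ≤ K * (c * γ) := by
          gcongr
          exact (not_le.1 h).le
        _ = _ := by ring
  unfold meanRho
  rw [← integral_sub (hρ.integrable Q _ _) (hρ.integrable Q _ _)]
  calc _ ≤ ∫ _, K * c * γ ∂Q := by
        refine integral_mono ((hρ.integrable Q _ _).sub (hρ.integrable Q _ _))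
          (integrable_const _) fun x => ?_
        have h := hpt ((x - t) / s)
        rwa [div_div, mul_comm s] at h
    _ = _ := by simp

/-- Stability of the S-location, uniformly over the contamination neighborhood: a distribution `Q`
whose mean losses are close to those of `F` has its S-locations close to that of `F`. Only the
upper bound `σ(Q) ≤ (1 + γ) * σ(F)` on the S-scale of `Q` is needed, and it comes from the gap
in the scale at the S-location of `F`. -/
theorem exists_stability (hρ : IsBoundedLoss ρ c) (hd : Differentiable ℝ ρ)
    (hd2 : Differentiable ℝ (deriv ρ)) {K : ℝ} (hK : ∀ u, |deriv ρ u| ≤ K)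
    {b ε μ₀ σ₀ : ℝ} (hb : 0 < b) (hε : ε ∈ Ioo (0 : ℝ) (1 / 2)) (hσ₀ : 0 < σ₀)
    {F₀ : ProbabilityMeasure ℝ}
    (hscale : ∀ F ∈ contamination ε F₀ μ₀ σ₀, ∀ t : ℝ, ∃! s : ℝ, 0 < s ∧ meanRho ρ F t s = b)
    {sMinus sPlus tStar : ℝ} (hsMinus : 0 < sMinus) (hs : sMinus ≤ sPlus)
    (hbounds : ∀ F ∈ contamination ε F₀ μ₀ σ₀, sScale ρ b F / σ₀ ∈ Icc sMinus sPlus)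
    (hsep : SeparationCondition ρ F₀ ε sMinus sPlus tStar)
    (hconv : ConvexityCondition ρ F₀ ε sMinus sPlus tStar) {δ : ℝ} (hδ : 0 < δ) :
    ∃ η, 0 < η ∧ ∀ F ∈ contamination ε F₀ μ₀ σ₀, ∀ tF, IsSLocation ρ b F tF →
      ∀ (Q : Measure ℝ) [IsProbabilityMeasure Q],
        (∀ t s, 0 < s → |meanRho ρ Q t s - meanRho ρ F t s| ≤ η) →
          ∀ tQ, IsSLocation ρ b Q tQ → |tQ - tF| ≤ δ := by
  have h1ε : 0 < 1 - ε := by linarith [hε.2]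
  have hK0 : 0 ≤ K := (abs_nonneg _).trans (hK 0)
  have hc := hρ.c_pos
  obtain ⟨κ, a, hκ, ha, hgrowth⟩ :=
    exists_growth (μ₀ := μ₀) hρ hd hd2 hK hε hσ₀ hsMinus hs hsep hconv
  set d := min κ (a * δ ^ 2) with hd_def
  have hd0 : 0 < d := lt_min hκ (by positivity)
  -- the change of the mean loss under the scale factor `1 + γ` is at most `d / 4`
  set γ := d / (4 * (K * c + 1)) with hγ_def
  have hγ : 0 < γ := by positivity
  have hγd : K * c * γ ≤ d / 4 := by
    rw [hγ_def, mul_div_assoc', div_le_div_iff₀ (by positivity) (by norm_num)]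
    nlinarith
  obtain ⟨g, hg, hgap⟩ := exists_scale_gap (tStar := tStar) (sPlus := sPlus) hρ hε hσ₀ hscale
    hsMinus hγ
  refine ⟨min (d / 4) ((1 - ε) * g), lt_min (by linarith) (by positivity), ?_⟩
  intro F hF tF htF Q _ hQ tQ htQ
  set S := sScale ρ b F with hS_def
  have hSI := hbounds F hF
  have hS0 : 0 < S := by
    have := mul_pos (hsMinus.trans_le hSI.1) hσ₀
    rwa [div_mul_cancel₀ _ hσ₀.ne'] at this
  have hval : meanRho ρ F tF S = b := hρ.meanRho_sScale_eq hb F hS0 htF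
  obtain ⟨htF_mem, hgr⟩ := hgrowth F hF S hSI tF
    fun t => hval.trans_le (hρ.le_meanRho_sScale hb F hS0 t)
  have hγS : 0 < (1 + γ) * S := by positivity
  have hle : meanRho ρ F tF ((1 + γ) * S) ≤ b - (1 - ε) * g := by
    obtain ⟨H, hH⟩ := hF
    have h1 := hval
    rw [meanRho_contamination hρ hε hσ₀ hH] at h1 ⊢
    have h2 := hρ.meanRho_nonneg H tF S
    have h3 := hρ.meanRho_le_one H tF S
    have h4 := hρ.meanRho_anti H tF hS0 (show S ≤ (1 + γ) * S by nlinarith)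
    have h5 := hgap _ htF_mem _ hSI (by nlinarith [hε.1]) (by nlinarith [hε.1])
    rw [← mul_div_assoc] at h5
    have h6 := mul_le_mul_of_nonneg_left h5 h1ε.le
    have h7 := mul_le_mul_of_nonneg_left h4 hε.1.le
    linarith
  have hQF : meanRho ρ Q tF ((1 + γ) * S) ≤ b := by
    have h1 := (abs_le.1 (hQ tF _ hγS)).2
    have h2 := min_le_right (d / 4) ((1 - ε) * g)
    linarith
  have hQQ : meanRho ρ Q tQ ((1 + γ) * S) ≤ b :=
    (hρ.scaleAt_le_iff hb Q tQ hγS).1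
      ((htQ (mem_univ tF)).trans ((hρ.scaleAt_le_iff hb Q tF hγS).2 hQF))
  have hfin : meanRho ρ F tQ S - meanRho ρ F tF S < d := by
    have h1 := (abs_le.1 (hQ tQ _ hγS)).1
    have h2 := min_le_left (d / 4) ((1 - ε) * g)
    have h3 := meanRho_sub_le_of_scale hρ hd hK F tQ S hγ
    linarith
  have hlt := (hgr tQ).trans_lt hfin
  by_contra hcon
  have h1 : δ ^ 2 ≤ (tQ - tF) ^ 2 := by
    rw [← sq_abs (tQ - tF)]
    exact pow_le_pow_left₀ hδ.le (not_le.1 hcon).le 2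
  exact absurd hlt (not_lt.2 (min_le_min_left κ (mul_le_mul_of_nonneg_left h1 ha.le)))

end Stability

/-! ### Kolmogorov distance and mean losses -/

section Kolmogorov

open ProbabilityTheory

theorem tendsto_measureReal_Iic_sub (F : Measure ℝ) [IsProbabilityMeasure F] (x : ℝ) :
    Tendsto (fun n : ℕ => F.real (Iic (x - 1 / ((n : ℝ) + 1)))) atTop (𝓝 (F.real (Iio x))) := by
  have hU : Iio x = ⋃ n : ℕ, Iic (x - 1 / ((n : ℝ) + 1)) := by
    ext y
    simp only [mem_Iio, mem_iUnion, mem_Iic]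
    constructor
    · intro h
      obtain ⟨n, hn⟩ := exists_nat_one_div_lt (sub_pos.2 h)
      exact ⟨n, by linarith⟩
    · rintro ⟨n, hn⟩
      have : (0 : ℝ) < 1 / ((n : ℝ) + 1) := by positivity
      linarith
  have hmono : Monotone fun n : ℕ => Iic (x - 1 / ((n : ℝ) + 1)) := by
    intro m n hmn
    refine Iic_subset_Iic.2 (sub_le_sub_left ?_ _)
    gcongr
  rw [hU]
  exact (ENNReal.tendsto_toReal (measure_ne_top _ _)).comp (tendsto_measure_iUnion_atTop hmono)

/-- Existence of a `p`-quantile, the smallest point at which the distribution function of `F`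
reaches `p`. -/
theorem exists_quantile (F : Measure ℝ) [IsProbabilityMeasure F] {p : ℝ} (hp : p ∈ Ioo (0 : ℝ) 1) :
    ∃ q, p ≤ F.real (Iic q) ∧ F.real (Iio q) ≤ p ∧ ∀ x, p ≤ F.real (Iic x) → q ≤ x := by
  set A : Set ℝ := {x | p ≤ F.real (Iic x)} with hA
  have hne : A.Nonempty := by
    obtain ⟨x, hx⟩ := ((tendsto_cdf_atTop F).eventually (Ioi_mem_nhds hp.2)).exists
    rw [cdf_eq_real] at hx
    exact ⟨x, le_of_lt hx⟩
  have hbdd : BddBelow A := by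
    obtain ⟨x, hx⟩ := ((tendsto_cdf_atBot F).eventually (Iio_mem_nhds hp.1)).exists
    rw [cdf_eq_real] at hx
    refine ⟨x, fun y hy => ?_⟩
    by_contra h
    have h1 : F.real (Iic y) ≤ F.real (Iic x) := measureReal_mono (Iic_subset_Iic.2 (not_le.1 h).le)
    have h2 : p ≤ F.real (Iic y) := hy
    have h3 : F.real (Iic x) < p := hx
    linarith
  have hle : ∀ x, p ≤ F.real (Iic x) → sInf A ≤ x := fun x hx => csInf_le hbdd hx
  refine ⟨sInf A, ?_, ?_, hle⟩
  · have hr := ((cdf F).right_continuous (sInf A)).tendsto.mono_left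
      (nhdsWithin_mono _ Ioi_subset_Ici_self)
    rw [cdf_eq_real] at hr
    refine ge_of_tendsto hr (eventually_mem_nhdsWithin.mono fun x hx => ?_)
    obtain ⟨y, hy, hyx⟩ := exists_lt_of_csInf_lt hne hx
    rw [cdf_eq_real]
    exact le_trans hy (measureReal_mono (Iic_subset_Iic.2 hyx.le))
  · refine le_of_tendsto (tendsto_measureReal_Iic_sub F (sInf A)) (Eventually.of_forall fun n => ?_)
    by_contra h
    have h1 := hle _ (not_le.1 h).le
    have : (0 : ℝ) < 1 / ((n : ℝ) + 1) := by positivity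
    linarith

/-- For every `k` the Kolmogorov distance to `F` is controlled, up to an error `1 / k`, by the
half-lines ending at fewer than `k` quantiles of `F`. -/
theorem exists_quantile_grid (F : Measure ℝ) [IsProbabilityMeasure F] (k : ℕ) (hk : 0 < k) :
    ∃ q : ℕ → ℝ, ∀ (P : Measure ℝ) [IsProbabilityMeasure P] (η : ℝ), 0 ≤ η →
      (∀ j < k, |P.real (Iic (q j)) - F.real (Iic (q j))| ≤ η ∧
        |P.real (Iio (q j)) - F.real (Iio (q j))| ≤ η) →
      ∀ x, |P.real (Iic x) - F.real (Iic x)| ≤ η + 1 / k := by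
  have hk' : (0 : ℝ) < k := by exact_mod_cast hk
  have hq : ∀ j : ℕ, ∃ q, 0 < j → j < k → (j : ℝ) / k ≤ F.real (Iic q) ∧
      F.real (Iio q) ≤ (j : ℝ) / k ∧ ∀ x, (j : ℝ) / k ≤ F.real (Iic x) → q ≤ x := by
    intro j
    by_cases h : 0 < j ∧ j < k
    · obtain ⟨q, hq⟩ := exists_quantile F (p := (j : ℝ) / k)
        ⟨div_pos (by exact_mod_cast h.1) hk', (div_lt_one hk').2 (by exact_mod_cast h.2)⟩
      exact ⟨q, fun _ _ => hq⟩
    · exact ⟨0, fun h1 h2 => (h ⟨h1, h2⟩).elim⟩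
  choose q hq using hq
  refine ⟨q, fun P _ η hη hPF x => ?_⟩
  -- `j / k ≤ F (Iic x) < (j + 1) / k`
  set j := ⌊k * F.real (Iic x)⌋₊ with hj
  have hF0 : 0 ≤ F.real (Iic x) := measureReal_nonneg
  have hj1 : (j : ℝ) / k ≤ F.real (Iic x) := by
    rw [div_le_iff₀ hk', mul_comm]
    exact Nat.floor_le (by positivity)
  have hj2 : F.real (Iic x) < (j + 1 : ℝ) / k := by
    rw [lt_div_iff₀ hk', mul_comm]
    exact Nat.lt_floor_add_one _
  rw [add_div] at hj2
  have hlow : ∀ i : ℕ, 0 < i → i < k → (i : ℝ) / k ≤ F.real (Iic x) →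
      (i : ℝ) / k - η ≤ P.real (Iic x) := by
    intro i hi hik h
    obtain ⟨h1, -, h3⟩ := hq i hi hik
    have h4 : P.real (Iic (q i)) ≤ P.real (Iic x) := measureReal_mono (Iic_subset_Iic.2 (h3 x h))
    have h5 := (abs_le.1 (hPF i hik).1).1
    linarith
  have hup : ∀ i : ℕ, 0 < i → i < k → F.real (Iic x) < (i : ℝ) / k →
      P.real (Iic x) ≤ (i : ℝ) / k + η := by
    intro i hi hik h
    obtain ⟨h1, h2, -⟩ := hq i hi hik
    have hx : x < q i := by
      by_contra hx
      have : F.real (Iic (q i)) ≤ F.real (Iic x) :=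
        measureReal_mono (Iic_subset_Iic.2 (not_lt.1 hx))
      linarith
    have h4 : P.real (Iic x) ≤ P.real (Iio (q i)) := measureReal_mono (Iic_subset_Iio.2 hx)
    have h5 := (abs_le.1 (hPF i hik).2).2
    linarith
  have hP0 : 0 ≤ P.real (Iic x) := measureReal_nonneg
  have hP1 : P.real (Iic x) ≤ 1 := measureReal_le_one
  have hF1 : F.real (Iic x) ≤ 1 := measureReal_le_one
  rw [abs_le]
  constructor
  · rcases Nat.eq_zero_or_pos j with h0 | h0
    · simp only [h0, Nat.cast_zero, zero_div] at hj2
      linarith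
    · rcases lt_or_ge j k with h | h
      · linarith [hlow j h0 h hj1]
      -- here `F (Iic x) = 1`, and the last quantile suffices
      · rcases Nat.lt_or_ge 1 k with hk1 | hk1
        · have h1 : ((k - 1 : ℕ) : ℝ) / k = 1 - 1 / k := by
            rw [Nat.cast_sub hk]
            field_simp
            simp
          have h2 : (1 : ℝ) ≤ (j : ℝ) / k := by
            rw [le_div_iff₀ hk', one_mul]
            exact_mod_cast h
          have h3 : (0 : ℝ) < 1 / k := by positivity
          have := hlow (k - 1) (by omega) (by omega) (by linarith)
          linarith
        · have : (k : ℝ) = 1 := by exact_mod_cast le_antisymm hk1 hk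
          rw [this]
          linarith
  · rcases lt_or_ge (j + 1) k with h | h
    · have := hup (j + 1) (by omega) h (by push_cast; rw [add_div]; exact hj2)
      push_cast at this
      rw [add_div] at this
      linarith
    · have h2 : (1 : ℝ) ≤ ((j + 1 : ℕ) : ℝ) / k := by
        rw [le_div_iff₀ hk', one_mul]
        exact_mod_cast h
      push_cast at h2
      rw [add_div] at h2
      linarith

variable {ρ : ℝ → ℝ} {c : ℝ}

/-- The mean loss is a mixture over levels `u` of probabilities of complements of bounded open
intervals, hence is controlled by the Kolmogorov distance, uniformly in location and scale. -/
theorem abs_meanRho_sub_le (hρ : IsBoundedLoss ρ c) (P F : Measure ℝ) [IsProbabilityMeasure P]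
    [IsProbabilityMeasure F] {η : ℝ} (h : ∀ x, |P.real (Iic x) - F.real (Iic x)| ≤ η) (t : ℝ)
    {s : ℝ} (hs : 0 < s) : |meanRho ρ P t s - meanRho ρ F t s| ≤ 2 * η := by
  have hIio : ∀ x, |P.real (Iio x) - F.real (Iio x)| ≤ η := fun x =>
    le_of_tendsto ((tendsto_measureReal_Iic_sub P x).sub (tendsto_measureReal_Iic_sub F x)).abs
      (Eventually.of_forall fun n => h _)
  have hset : ∀ u ∈ Ioc (0 : ℝ) 1, ∃ l r : ℝ, l < r ∧
      {x | u ≤ ρ ((x - t) / s)} = (Iio r \ Iic l)ᶜ := by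
    intro u hu
    set A : Set ℝ := Ici 0 ∩ ρ ⁻¹' Ici u with hA
    have hcl : IsClosed A := isClosed_Ici.inter (isClosed_Ici.preimage hρ.continuous)
    have hne : A.Nonempty :=
      ⟨c, hρ.c_pos.le, by rw [mem_preimage, hρ.eq_one c (le_abs_self c)]; exact hu.2⟩
    have hbdd : BddBelow A := ⟨0, fun _ h => h.1⟩
    obtain ⟨hw0, hwu⟩ := hcl.csInf_mem hne hbdd
    set w := sInf A
    have hw0' : 0 ≤ w := hw0
    have hwu' : u ≤ ρ w := hwu
    have hw : ∀ v, u ≤ ρ v ↔ w ≤ |v| := by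
      intro v
      constructor
      · intro h
        exact csInf_le hbdd ⟨abs_nonneg v, by rw [mem_preimage, hρ.apply_abs]; exact h⟩
      · intro h
        exact hwu'.trans (hρ.le_of_abs_le (by rwa [abs_of_nonneg hw0']))
    have hwpos : 0 < w := by
      refine lt_of_le_of_ne hw0' fun h0 => ?_
      rw [← h0, hρ.zero] at hwu'
      exact absurd hu.1 (not_lt.2 hwu')
    refine ⟨t - w * s, t + w * s, by nlinarith [mul_pos hwpos hs], ?_⟩
    ext x
    simp only [mem_ofPred_eq, hw, mem_compl_iff, Set.mem_sdiff, mem_Iio, mem_Iic, not_and, not_not]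
    rw [abs_div, abs_of_pos hs, le_div_iff₀ hs, le_abs]
    constructor
    · rintro (h1 | h1) h2 <;> linarith
    · intro h1
      by_cases h2 : x < t + w * s
      · right
        linarith [h1 h2]
      · left
        linarith [not_lt.1 h2]
  have hlevel : ∀ u ∈ Ioc (0 : ℝ) 1,
      ‖P.real {x | u ≤ ρ ((x - t) / s)} - F.real {x | u ≤ ρ ((x - t) / s)}‖ ≤ 2 * η := by
    intro u hu
    obtain ⟨l, r, hlr, he⟩ := hset u hu
    have hm : MeasurableSet (Iio r \ Iic l) := measurableSet_Iio.diff measurableSet_Iic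
    rw [he, probReal_compl_eq_one_sub hm, probReal_compl_eq_one_sub hm,
      measureReal_sdiff (Iic_subset_Iio.2 hlr) measurableSet_Iic,
      measureReal_sdiff (Iic_subset_Iio.2 hlr) measurableSet_Iic, Real.norm_eq_abs, abs_le]
    have h1 := abs_le.1 (hIio r)
    have h2 := abs_le.1 (h l)
    constructor <;> linarith [h1.1, h1.2, h2.1, h2.2]
  have hint : ∀ (Q : Measure ℝ) [IsProbabilityMeasure Q],
      IntegrableOn (fun u => Q.real {x | u ≤ ρ ((x - t) / s)}) (Ioc 0 1) := by
    intro Q _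
    have hanti : Antitone fun u => Q.real {x | u ≤ ρ ((x - t) / s)} :=
      fun u v huv => measureReal_mono fun x (hx : v ≤ _) => huv.trans hx
    refine Integrable.of_bound (C := 1) hanti.measurable.aestronglyMeasurable
      (ae_of_all _ fun u => ?_)
    rw [Real.norm_of_nonneg measureReal_nonneg]
    exact measureReal_le_one
  have hcake : ∀ (Q : Measure ℝ) [IsProbabilityMeasure Q],
      meanRho ρ Q t s = ∫ u in Ioc (0 : ℝ) 1, Q.real {x | u ≤ ρ ((x - t) / s)} := fun Q _ =>
    (hρ.integrable Q t s).integral_eq_integral_Ioc_meas_le (ae_of_all _ fun _ => hρ.nonneg _)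
      (ae_of_all _ fun _ => hρ.le_one _)
  rw [hcake P, hcake F, ← integral_sub (hint P) (hint F), ← Real.norm_eq_abs]
  have := norm_setIntegral_le_of_norm_le_const (μ := volume) (s := Ioc (0 : ℝ) 1) (by simp)
    hlevel
  simpa using this

end Kolmogorov

/-! ### Empirical measures -/

section Empirical

open ProbabilityTheory

/-- The empirical measure of a sample: mass `1 / n` at each observation, counted with
multiplicity. It is a probability measure for `n ≥ 1`. -/
noncomputable def empiricalMeasure {n : ℕ} (x : Fin n → ℝ) : Measure ℝ :=
  ENNReal.ofReal (1 / (n : ℝ)) • ∑ i, Measure.dirac (x i)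

theorem isProbabilityMeasure_empiricalMeasure {n : ℕ} (hn : 1 ≤ n) (x : Fin n → ℝ) :
    IsProbabilityMeasure (empiricalMeasure x) := by
  constructor
  have hn' : (0 : ℝ) < n := by exact_mod_cast hn
  simp only [empiricalMeasure, Measure.coe_smul, Pi.smul_apply, Measure.coe_finsetSum,
    Finset.sum_apply, measure_univ, Finset.sum_const, Finset.card_univ, Fintype.card_fin,
    nsmul_eq_mul, mul_one, smul_eq_mul]
  rw [← ENNReal.ofReal_natCast, ← ENNReal.ofReal_mul (by positivity), one_div_mul_cancel hn'.ne']
  simp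

theorem meanRho_empiricalMeasure (ρ : ℝ → ℝ) {n : ℕ} (x : Fin n → ℝ) (t s : ℝ) :
    meanRho ρ (empiricalMeasure x) t s = sampleMeanRho ρ x t s := by
  unfold meanRho sampleMeanRho empiricalMeasure
  rw [integral_smul_measure, integral_finsetSum_measure fun i _ => integrable_dirac (by simp),
    ENNReal.toReal_ofReal (by positivity)]
  simp

theorem isSampleSLocation_iff (ρ : ℝ → ℝ) (b : ℝ) {n : ℕ} (x : Fin n → ℝ) (t : ℝ) :
    IsSampleSLocation ρ b x t ↔ IsSLocation ρ b (empiricalMeasure x) t := by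
  have h : sampleScaleAt ρ b x = scaleAt ρ b (empiricalMeasure x) := by
    funext t
    unfold sampleScaleAt scaleAt
    congr 1
    funext s
    exact (meanRho_empiricalMeasure ρ x t s).symm
  rw [IsSampleSLocation, IsSLocation, h]

theorem empiricalMeasure_real {n : ℕ} (x : Fin n → ℝ) {A : Set ℝ} (hA : MeasurableSet A) :
    (empiricalMeasure x).real A = (1 / (n : ℝ)) * ∑ i, A.indicator 1 (x i) := by
  rw [← integral_indicator_one hA]
  unfold empiricalMeasure
  rw [integral_smul_measure, integral_finsetSum_measure fun i _ => integrable_dirac (by simp),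
    ENNReal.toReal_ofReal (by positivity)]
  simp

/-- Hoeffding's inequality for the empirical frequency of a set. -/
theorem measure_le_empiricalMeasure_sub (F : Measure ℝ) [IsProbabilityMeasure F] {A : Set ℝ}
    (hA : MeasurableSet A) {n : ℕ} (hn : 1 ≤ n) {η : ℝ} (hη : 0 ≤ η) :
    (Measure.infinitePi fun _ : ℕ => F).real
      {ω | η ≤ (empiricalMeasure fun i : Fin n => ω i).real A - F.real A} ≤
      Real.exp (-2 * η ^ 2) ^ n := by
  set μ := Measure.infinitePi fun _ : ℕ => F with hμ
  have hn' : (0 : ℝ) < n := by exact_mod_cast hn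
  set f : ℝ → ℝ := A.indicator 1 with hf
  have hfm : Measurable f := measurable_one.indicator hA
  have hmean : ∀ i : ℕ, ∫ ω, f (ω i) ∂μ = F.real A := by
    intro i
    have hmp := measurePreserving_eval_infinitePi (fun _ : ℕ => F) i
    have := integral_map (μ := μ) (φ := Function.eval i) (measurable_pi_apply i).aemeasurable
      (f := f) hfm.aestronglyMeasurable
    rw [hμ, hmp.map_eq, integral_indicator_one hA] at this
    exact this.symm
  have hsub : ∀ i : ℕ, HasSubgaussianMGF (fun ω : ℕ → ℝ => f (ω i) - F.real A)
      ((‖(1 : ℝ) - 0‖₊ / 2) ^ 2) μ := by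
    intro i
    have := hasSubgaussianMGF_of_mem_Icc (μ := μ) (X := fun ω : ℕ → ℝ => f (ω i)) (a := 0) (b := 1)
      (hfm.comp (measurable_pi_apply i)).aemeasurable
      (ae_of_all _ fun ω => ⟨indicator_nonneg (fun _ _ => zero_le_one) _,
        indicator_le_self' (f := 1) (fun _ _ => zero_le_one) _⟩)
    rwa [hmean i] at this
  have hind : iIndepFun (fun (i : ℕ) (ω : ℕ → ℝ) => f (ω i) - F.real A) μ :=
    iIndepFun_infinitePi (X := fun _ x => f x - F.real A) fun _ => hfm.sub_const _
  have := HasSubgaussianMGF.measure_sum_range_ge_le_of_iIndepFun hind (n := n)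
    (fun i _ => hsub i) (ε := n * η) (by positivity)
  convert this using 1
  · congr 1
    ext ω
    simp only [mem_ofPred_eq]
    rw [empiricalMeasure_real _ hA, Finset.sum_sub_distrib, Finset.sum_const, Finset.card_range,
      nsmul_eq_mul, Fin.sum_univ_eq_sum_range (fun i => A.indicator (1 : ℝ → ℝ) (ω i)),
      ← mul_le_mul_iff_right₀ hn']
    rw [mul_sub, ← mul_assoc, mul_one_div_cancel hn'.ne', one_mul]
  · rw [← Real.exp_nat_mul]
    congr 1
    simp
    field_simp

end Empirical

/-! ### The uniform Glivenko–Cantelli theorem -/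

section GlivenkoCantelli

theorem measure_le_abs_empiricalMeasure_sub (F : Measure ℝ) [IsProbabilityMeasure F] {A : Set ℝ}
    (hA : MeasurableSet A) {n : ℕ} (hn : 1 ≤ n) {η : ℝ} (hη : 0 ≤ η) :
    (Measure.infinitePi fun _ : ℕ => F)
      {ω | η ≤ |(empiricalMeasure fun i : Fin n => ω i).real A - F.real A|} ≤
      2 * ENNReal.ofReal (Real.exp (-2 * η ^ 2)) ^ n := by
  have h1 : ∀ B : Set ℝ, MeasurableSet B → (Measure.infinitePi fun _ : ℕ => F)
      {ω | η ≤ (empiricalMeasure fun i : Fin n => ω i).real B - F.real B} ≤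
      ENNReal.ofReal (Real.exp (-2 * η ^ 2)) ^ n := by
    intro B hB
    rw [← ENNReal.ofReal_pow (Real.exp_nonneg _)]
    exact (ENNReal.le_ofReal_iff_toReal_le (measure_ne_top _ _) (by positivity)).2
      (measure_le_empiricalMeasure_sub F hB hn hη)
  rw [two_mul]
  refine (measure_mono ?_).trans
    ((measure_union_le _ _).trans (add_le_add (h1 A hA) (h1 Aᶜ hA.compl)))
  intro ω hω
  have := isProbabilityMeasure_empiricalMeasure hn fun i : Fin n => ω i
  rcases le_abs.1 (show η ≤ |_| from hω) with h | h
  · exact Or.inl h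
  · right
    show η ≤ _
    rw [probReal_compl_eq_one_sub hA, probReal_compl_eq_one_sub hA]
    linarith

/-- An exponential bound for the Kolmogorov distance of the empirical measure, with constants that
do not depend on the distribution. -/
theorem measure_exists_lt_abs_sub_le (F : Measure ℝ) [IsProbabilityMeasure F] {n : ℕ} (hn : 1 ≤ n)
    {k : ℕ} (hk : 0 < k) {η : ℝ} (hη : 0 ≤ η) :
    (Measure.infinitePi fun _ : ℕ => F)
      {ω | ∃ x, η + 1 / k <
        |(empiricalMeasure fun i : Fin n => ω i).real (Iic x) - F.real (Iic x)|} ≤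
      4 * k * ENNReal.ofReal (Real.exp (-2 * η ^ 2)) ^ n := by
  obtain ⟨q, hq⟩ := exists_quantile_grid F k hk
  set B : Set ℝ → Set (ℕ → ℝ) := fun A =>
    {ω | η ≤ |(empiricalMeasure fun i : Fin n => ω i).real A - F.real A|} with hB
  have hsub : {ω : ℕ → ℝ | ∃ x, η + 1 / k <
      |(empiricalMeasure fun i : Fin n => ω i).real (Iic x) - F.real (Iic x)|} ⊆
      ⋃ j ∈ Finset.range k, (B (Iic (q j)) ∪ B (Iio (q j))) := by
    rintro ω ⟨x, hx⟩
    by_contra h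
    have := isProbabilityMeasure_empiricalMeasure hn fun i : Fin n => ω i
    refine absurd hx (not_lt.2 (hq _ η hη (fun j hj => ?_) x))
    simp only [mem_iUnion, not_exists] at h
    have h1 := h j (Finset.mem_range.2 hj)
    rw [mem_union, not_or] at h1
    exact ⟨(not_le.1 h1.1).le, (not_le.1 h1.2).le⟩
  refine (measure_mono hsub).trans ((measure_biUnion_finset_le _ _).trans ?_)
  calc ∑ j ∈ Finset.range k, (Measure.infinitePi fun _ : ℕ => F) (B (Iic (q j)) ∪ B (Iio (q j)))
      ≤ ∑ j ∈ Finset.range k, 4 * ENNReal.ofReal (Real.exp (-2 * η ^ 2)) ^ n := by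
        refine Finset.sum_le_sum fun j _ => (measure_union_le _ _).trans ?_
        refine (add_le_add (measure_le_abs_empiricalMeasure_sub F measurableSet_Iic hn hη)
          (measure_le_abs_empiricalMeasure_sub F measurableSet_Iio hn hη)).trans_eq ?_
        ring
    _ = _ := by
        rw [Finset.sum_const, Finset.card_range, nsmul_eq_mul]
        ring

/-- The Glivenko–Cantelli theorem with almost sure convergence uniform over all distributions. -/
theorem tendsto_iSup_measure_exists_lt_abs_sub {η : ℝ} (hη : 0 < η) :
    Tendsto (fun m : ℕ => ⨆ F : ProbabilityMeasure ℝ,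
      (Measure.infinitePi fun _ : ℕ => (F : Measure ℝ)) {ω | ∃ n ≥ m, ∃ x,
        η < |(empiricalMeasure fun i : Fin n => ω i).real (Iic x) - (F : Measure ℝ).real (Iic x)|})
      atTop (𝓝 0) := by
  obtain ⟨k, hk⟩ := exists_nat_one_div_lt (half_pos hη)
  have hk' : η / 2 + 1 / ((k + 1 : ℕ) : ℝ) ≤ η := by
    push_cast
    linarith
  set r := ENNReal.ofReal (Real.exp (-2 * (η / 2) ^ 2)) with hr
  have hr1 : r < 1 := by
    rw [hr, ENNReal.ofReal_lt_one, Real.exp_lt_one_iff]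
    have : 0 < (η / 2) ^ 2 := by positivity
    linarith
  set C : ENNReal := 4 * (k + 1 : ℕ) with hC
  have hCtop : C ≠ ⊤ := ENNReal.mul_ne_top (by simp) (ENNReal.natCast_ne_top _)
  have hlim : Tendsto (fun m : ℕ => C * (r ^ m * (1 - r)⁻¹)) atTop (𝓝 0) := by
    have h1 := ENNReal.tendsto_pow_atTop_nhds_zero_of_lt_one hr1
    have h2 : (1 - r)⁻¹ ≠ ⊤ := ENNReal.inv_ne_top.2 (tsub_pos_of_lt hr1).ne'
    have h3 := ENNReal.Tendsto.const_mul (ENNReal.Tendsto.mul_const h1 (Or.inr h2))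
      (Or.inr hCtop)
    simpa using h3
  refine tendsto_of_tendsto_of_tendsto_of_le_of_le' tendsto_const_nhds hlim
    (Eventually.of_forall fun _ => zero_le) ?_
  filter_upwards [eventually_ge_atTop 1] with m hm
  refine iSup_le fun F => ?_
  have hsub : {ω : ℕ → ℝ | ∃ n ≥ m, ∃ x, η <
      |(empiricalMeasure fun i : Fin n => ω i).real (Iic x) - (F : Measure ℝ).real (Iic x)|} ⊆
      ⋃ n : ℕ, {ω | ∃ x, η / 2 + 1 / ((k + 1 : ℕ) : ℝ) <
        |(empiricalMeasure fun i : Fin (n + m) => ω i).real (Iic x) -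
          (F : Measure ℝ).real (Iic x)|} := by
    rintro ω ⟨n, hn, x, hx⟩
    obtain ⟨l, rfl⟩ := Nat.exists_eq_add_of_le' hn
    exact mem_iUnion.2 ⟨l, x, hk'.trans_lt hx⟩
  refine (measure_mono hsub).trans ((measure_iUnion_le _).trans ?_)
  calc _ ≤ ∑' n : ℕ, C * (r ^ n * r ^ m) := by
        refine ENNReal.tsum_le_tsum fun n => ?_
        rw [← pow_add]
        exact measure_exists_lt_abs_sub_le (F : Measure ℝ) (by omega) (Nat.succ_pos k)
          (by positivity)
    _ = _ := by
        rw [ENNReal.tsum_mul_left, ENNReal.tsum_mul_right, ENNReal.tsum_geometric, mul_comm (r ^ m)]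

end GlivenkoCantelli

/-! ### Uniform consistency -/

theorem theorem2
    (ρ : ℝ → ℝ) (b ε : ℝ) (F₀ : ProbabilityMeasure ℝ) (μ₀ σ₀ sMinus sPlus tStar : ℝ)
    -- the function `ρ`
    (hρ_zero : ρ 0 = 0)
    (hρ_even : ∀ u, 0 ≤ u → ρ (-u) = ρ u)
    (hρ_sup : IsLUB (range ρ) 1)
    (hρ_mono : MonotoneOn ρ (Ici 0))
    (hρ_diff : Differentiable ℝ ρ)
    (hρ_diff2 : Differentiable ℝ (deriv ρ))
    (hρ_deriv : ∃ K : ℝ, ∀ u, |deriv ρ u| ≤ K)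
    (hρ_const : ∃ c : ℝ, 0 < c ∧ ∀ u, c ≤ |u| → ρ u = 1)
    -- the contamination model
    (hb : b ∈ Ioo (0 : ℝ) 1)
    (hε : ε ∈ Ioo (0 : ℝ) (1 / 2))
    (hF₀ : (F₀ : Measure ℝ).map (fun x => -x) = (F₀ : Measure ℝ))
    (hσ₀ : 0 < σ₀)
    -- the equation defining `σ(F, t)` has exactly one solution
    (hscale : ∀ F ∈ contamination ε F₀ μ₀ σ₀, ∀ t : ℝ, ∃! s : ℝ, 0 < s ∧ meanRho ρ F t s = b)
    -- `s⁻` and `s⁺` bound the S-scale over the neighborhood, in units of `σ₀`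
    (hsMinus : 0 < sMinus)
    (hbounds : ∀ F ∈ contamination ε F₀ μ₀ σ₀,
      sMinus ≤ sScale ρ b F / σ₀ ∧ sScale ρ b F / σ₀ ≤ sPlus)
    (hsep : SeparationCondition ρ F₀ ε sMinus sPlus tStar)
    (hconv : ConvexityCondition ρ F₀ ε sMinus sPlus tStar) :
    -- the S-location functional and estimates are defined, and the latter are uniformly consistent
    (∀ F ∈ contamination ε F₀ μ₀ σ₀, ∃! t : ℝ, IsSLocation ρ b F t) ∧
    (∀ n : ℕ, 1 ≤ n → ∀ x : Fin n → ℝ, ∃ t : ℝ, IsSampleSLocation ρ b x t) ∧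
    ∀ (muTilde : (n : ℕ) → (Fin n → ℝ) → ℝ) (muF : ProbabilityMeasure ℝ → ℝ),
      (∀ n : ℕ, 1 ≤ n → ∀ x : Fin n → ℝ, IsSampleSLocation ρ b x (muTilde n x)) →
      (∀ F ∈ contamination ε F₀ μ₀ σ₀, IsSLocation ρ b F (muF F)) →
      UniformlyConsistent (contamination ε F₀ μ₀ σ₀) muTilde muF := by
  obtain ⟨K, hK⟩ := hρ_deriv
  obtain ⟨c, hc, hρc⟩ := hρ_const
  have hρ : IsBoundedLoss ρ c :=
    { zero := hρ_zero
      even := fun u => by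
        rcases le_total 0 u with h | h
        · exact hρ_even u h
        · simpa using (hρ_even (-u) (by linarith)).symm
      mono := hρ_mono
      continuous := hρ_diff.continuous
      c_pos := hc
      eq_one := hρc }
  have hbounds' : ∀ F ∈ contamination ε F₀ μ₀ σ₀, sScale ρ b F / σ₀ ∈ Icc sMinus sPlus :=
    fun F hF => hbounds F hF
  have hs : sMinus ≤ sPlus := by
    obtain ⟨F, hF⟩ := exists_mem_contamination hε F₀ μ₀ σ₀ F₀
    exact (hbounds F ⟨F₀, hF⟩).1.trans (hbounds F ⟨F₀, hF⟩).2
  have hstab : ∀ {δ : ℝ}, 0 < δ → _ := fun {δ} hδ =>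
    exists_stability hρ hρ_diff hρ_diff2 hK hb.1 hε hσ₀ hscale hsMinus hs hbounds' hsep hconv hδ
  refine ⟨fun F hF => ?_, fun n hn x => ?_, fun muTilde muF hT hmuF δ hδ => ?_⟩
  · obtain ⟨t, ht⟩ := hρ.exists_isSLocation hb (F : Measure ℝ)
    refine ⟨t, ht, fun t' ht' => ?_⟩
    -- stability applied to `Q = F`
    have h0 : ∀ δ, 0 < δ → |t' - t| ≤ 0 + δ := by
      intro δ hδ
      obtain ⟨η, hη, h⟩ := hstab hδ
      rw [zero_add]
      exact h F hF t ht F (fun _ _ _ => by simpa using hη.le) t' ht'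
    exact sub_eq_zero.1 (abs_nonpos_iff.1 (le_of_forall_pos_le_add h0))
  · have := isProbabilityMeasure_empiricalMeasure hn x
    obtain ⟨t, ht⟩ := hρ.exists_isSLocation hb (empiricalMeasure x)
    exact ⟨t, (isSampleSLocation_iff ρ b x t).2 ht⟩
  · obtain ⟨η, hη, hstabη⟩ := hstab hδ
    refine tendsto_of_tendsto_of_tendsto_of_le_of_le' tendsto_const_nhds
      (tendsto_iSup_measure_exists_lt_abs_sub (half_pos hη))
      (Eventually.of_forall fun _ => zero_le) ?_
    filter_upwards [eventually_ge_atTop 1] with m hm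
    refine iSup₂_le fun F hF => le_iSup_of_le F (measure_mono ?_)
    intro ω hω
    obtain ⟨n, hω⟩ := lt_iSup_iff.1 (show (δ : EReal) < _ from hω)
    obtain ⟨hnm, hω⟩ := lt_iSup_iff.1 hω
    rw [EReal.coe_lt_coe_iff] at hω
    have hn : 1 ≤ n := hm.trans hnm
    have := isProbabilityMeasure_empiricalMeasure hn fun i : Fin n => ω i
    refine ⟨n, hnm, ?_⟩
    by_contra hcon
    simp only [not_exists, not_lt] at hcon
    refine absurd hω (not_lt.2 (hstabη F hF (muF F) (hmuF F hF) _
      (fun t s hs => ?_) _ ((isSampleSLocation_iff ρ b _ _).1 (hT n hn _))))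
    have := abs_meanRho_sub_le hρ _ _ hcon t hs
    linarith
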